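/- Let $I=[0,1]$, let $H_+$ be the group of increasing self-homeomorphisms of $I$ under composition, and let $H_+^{AC}$ be the subgroup of those $f\in H_+$ for which both $f$ and $f^{-1}$ are absolutely continuous, with the topology of the metric $\rho(f,g)=\int_0^1|f'-g'|\,d\lambda$, where $\lambda$ is Lebesgue measure. For $f\in H_+$ put $\mathrm{Fix}(f)=\{x\in I: f(x)=x\}$. The orbitals of $f$ of nonzero parity are the connected components of $I\setminus\mathrm{Fix}(f)$, with their natural left-to-right order; the orbital containing $x$ has positive parity if $f(x)>x$ and negative parity if $f(x)<x$. Let $C\subseteq H_+$ be the set of $f$ whose orbitals of nonzero parity form a (nonempty) dense linear order without endpoints in which the orbitals of positive parity and the orbitals of negative parity are each dense, and let $N\subseteq H_+$ be the set of $f$ such that $\mathrm{Fix}(f)$ is Lebesgue-null. An element of $H_+^{AC}$ is called generic if its conjugacy class in $H_+^{AC}$ is comeagre. Theorem. $H_+^{AC}$ has a generic element. An element $f\in H_+^{AC}$ is generic if and only if it has the following three properties: (i) $\mathrm{Fix}(f)$ is totally disconnected and has no isolated points (that is, it is a Cantor set); (ii) for any connected components $(a,b)$ and $(c,d)$ of $I\setminus\mathrm{Fix}(f)$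 with $b<c$, there are points $x,y\in(b,c)$ with $f(x)<x$ and $f(y)>y$; (iii) $\mathrm{Fix}(f)$ has Lebesgue measure zero. Moreover, the set of generic elements is $C\cap N\cap H_+^{AC}$; this set is a single conjugacy class of $H_+^{AC}$, and it is a dense $G_\delta$ subset of $H_+^{AC}$. -/

import Mathlib

open Set Filter Topology MeasureTheory

/-- `H₊`: the group of increasing self-homeomorphisms of `I = [0,1]`.  Since the topology of `I` is
its order topology, these are exactly the order isomorphisms of `I`.  Multiplication is
composition. -/
abbrev Hplus : Type := unitInterval ≃o unitInterval

namespace Hplus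

/-- `f ∈ H₊` as a function `ℝ → ℝ`, extended by constants (`0` and `1`) outside `[0,1]`. -/
noncomputable def ext (f : Hplus) : ℝ → ℝ :=
  Set.IccExtend (zero_le_one (α := ℝ)) (fun x : unitInterval => (f x : ℝ))

/-- `f` is absolutely continuous on `[0,1]`. -/
def IsAC (f : Hplus) : Prop := AbsolutelyContinuousOnInterval f.ext 0 1

theorem ext_coe (f : Hplus) (x : unitInterval) : f.ext x = f x :=
  Set.IccExtend_val _ _ x

theorem ext_of_mem (f : Hplus) {x : ℝ} (hx : x ∈ Icc (0 : ℝ) 1) : f.ext x = f ⟨x, hx⟩ :=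
  ext_coe f ⟨x, hx⟩

theorem ext_monotone (f : Hplus) : Monotone f.ext :=
  Monotone.IccExtend _ (fun _ _ h => f.monotone h)

theorem ext_mem (f : Hplus) (x : ℝ) : f.ext x ∈ Icc (0 : ℝ) 1 := by
  unfold ext Set.IccExtend
  exact (f _).2

theorem isAC_one : IsAC 1 := by
  have h : LipschitzOnWith 1 (ext 1) (uIcc (0 : ℝ) 1) := by
    intro x hx y hy
    rw [uIcc_of_le zero_le_one] at hx hy
    rw [ext_of_mem _ hx, ext_of_mem _ hy]
    simp
  exact h.absolutelyContinuousOnInterval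

theorem IsAC.mul {f g : Hplus} (hf : f.IsAC) (hg : g.IsAC) : (f * g).IsAC := by
  have key : ∀ x ∈ Icc (0 : ℝ) 1, (f * g).ext x = f.ext (g.ext x) := by
    intro x hx
    rw [ext_of_mem _ hx, ext_of_mem g hx, ext_coe]
    rfl
  unfold IsAC at *
  rw [absolutelyContinuousOnInterval_iff] at *
  intro ε hε
  obtain ⟨δ, hδ, h1⟩ := hf ε hε
  obtain ⟨η, hη, h2⟩ := hg δ hδ
  refine ⟨η, hη, fun E hE hs => ?_⟩
  have h3 := h1 (E.1, fun i => (g.ext (E.2 i).1, g.ext (E.2 i).2)) ?_ (h2 E hE hs)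
  · refine lt_of_le_of_lt (le_of_eq (Finset.sum_congr rfl fun i hi => ?_)) h3
    have := hE.1 i hi
    rw [uIcc_of_le zero_le_one] at this
    rw [key _ this.1, key _ this.2]
  · refine ⟨fun i _ => ?_, fun i hi j hj hij => ?_⟩
    · rw [uIcc_of_le zero_le_one]
      exact ⟨ext_mem g _, ext_mem g _⟩
    · have h := hE.2 hi hj hij
      simp only [Function.onFun, uIoc, Ioc_disjoint_Ioc, ← g.ext_monotone.map_max,
        ← g.ext_monotone.map_min] at h ⊢
      exact g.ext_monotone h

/-- The fixed point set of `f`. -/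
def Fix (f : Hplus) : Set unitInterval := {x | f x = x}

open Classical in
/-- The orbital of `x` under `f`: `{x}` if `x` is fixed, and otherwise the connected component of
`I \ Fix f` that contains `x`. -/
noncomputable def orbital (f : Hplus) (x : unitInterval) : Set unitInterval :=
  if x ∈ f.Fix then {x} else connectedComponentIn (f.Fix)ᶜ x

/-- The orbitals of nonzero parity, i.e. the connected components of `I \ Fix f`. -/
def nonzeroOrbitals (f : Hplus) : Set (Set unitInterval) :=
  {J | ∃ x, x ∉ f.Fix ∧ J = f.orbital x}

/-- The orbitals of positive parity. -/
def positiveOrbitals (f : Hplus) : Set (Set unitInterval) :=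
  {J | ∃ x, x < f x ∧ J = f.orbital x}

/-- The orbitals of negative parity. -/
def negativeOrbitals (f : Hplus) : Set (Set unitInterval) :=
  {J | ∃ x, f x < x ∧ J = f.orbital x}

/-- The natural strict order between orbitals: `J` lies entirely to the left of `K`. -/
def Precedes (J K : Set unitInterval) : Prop := ∀ x ∈ J, ∀ y ∈ K, x < y

/-- The set `C` of all `f ∈ H₊` for which the orbitals of nonzero parity form a (nonempty) dense
linear order without endpoints, in which both the orbitals of positive parity and the orbitals
of negative parity are dense. -/
def setC : Set Hplus :=
  {f | f.nonzeroOrbitals.Nonempty ∧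
    IsStrictTotalOrder f.nonzeroOrbitals (fun J K => Precedes J.1 K.1) ∧
    (∀ J ∈ f.nonzeroOrbitals, ∀ K ∈ f.nonzeroOrbitals, Precedes J K →
      ∃ L ∈ f.nonzeroOrbitals, Precedes J L ∧ Precedes L K) ∧
    (∀ J ∈ f.nonzeroOrbitals, ∃ L ∈ f.nonzeroOrbitals, Precedes L J) ∧
    (∀ J ∈ f.nonzeroOrbitals, ∃ L ∈ f.nonzeroOrbitals, Precedes J L) ∧
    (∀ J ∈ f.nonzeroOrbitals, ∀ K ∈ f.nonzeroOrbitals, Precedes J K →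
      ∃ L ∈ f.positiveOrbitals, Precedes J L ∧ Precedes L K) ∧
    (∀ J ∈ f.nonzeroOrbitals, ∀ K ∈ f.nonzeroOrbitals, Precedes J K →
      ∃ L ∈ f.negativeOrbitals, Precedes J L ∧ Precedes L K)}

/-- The set `N` of all `f ∈ H₊` whose fixed point set is Lebesgue-null. -/
def setN : Set Hplus :=
  {f | volume ((fun x : unitInterval => (x : ℝ)) '' f.Fix) = 0}

end Hplus

/-- `H₊^{AC}`: the subgroup of those `f ∈ H₊` such that both `f` and `f⁻¹` are absolutely
continuous. -/
def HplusAC : Subgroup Hplus where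
  carrier := {f | f.IsAC ∧ (f⁻¹).IsAC}
  mul_mem' {f g} hf hg := ⟨hf.1.mul hg.1, by rw [mul_inv_rev]; exact hg.2.mul hf.2⟩
  one_mem' := ⟨Hplus.isAC_one, by rw [inv_one]; exact Hplus.isAC_one⟩
  inv_mem' {f} hf := ⟨hf.2, by rw [inv_inv]; exact hf.1⟩

namespace HplusAC

/-- The metric `ρ(f,g) = ∫₀¹ |f' - g'| dλ` on `H₊^{AC}`; it is the source of the topology of
`H₊^{AC}`. -/
noncomputable def rho (f g : HplusAC) : ℝ :=
  ∫ x in (0 : ℝ)..1, |deriv f.1.ext x - deriv g.1.ext x|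

theorem intervalIntegrable_sub (f g : HplusAC) :
    IntervalIntegrable (fun x => deriv f.1.ext x - deriv g.1.ext x) volume 0 1 :=
  (AbsolutelyContinuousOnInterval.intervalIntegrable_deriv f.2.1).sub
    (AbsolutelyContinuousOnInterval.intervalIntegrable_deriv g.2.1)

theorem eq_of_rho_eq_zero (f g : HplusAC) (h : rho f g = 0) : f = g := by
  have hint := intervalIntegrable_sub f g
  apply Subtype.ext
  apply OrderIso.ext
  funext t
  apply Subtype.ext
  have h0 : ∀ k : Hplus, k.ext 0 = 0 := by
    intro k
    have h1 := k.ext_coe 0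
    have h2 : k 0 = 0 := k.map_bot
    rw [h2] at h1
    simpa using h1
  have hF : ∀ k : HplusAC, ∫ x in (0 : ℝ)..t, deriv k.1.ext x = k.1 t := by
    intro k
    have hk : AbsolutelyContinuousOnInterval k.1.ext 0 t := by
      refine AbsolutelyContinuousOnInterval.mono k.2.1 ?_
      rw [uIcc_of_le t.2.1, uIcc_of_le zero_le_one]
      exact Icc_subset_Icc_right t.2.2
    rw [hk.integral_deriv_eq_sub, h0, Hplus.ext_coe, sub_zero]
  have hsub : uIcc (0 : ℝ) t ⊆ uIcc 0 1 := by
    rw [uIcc_of_le t.2.1, uIcc_of_le zero_le_one]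
    exact Icc_subset_Icc_right t.2.2
  have hle : |∫ x in (0 : ℝ)..t, (deriv f.1.ext x - deriv g.1.ext x)| ≤ rho f g := by
    refine (intervalIntegral.abs_integral_le_integral_abs t.2.1).trans ?_
    exact intervalIntegral.integral_mono_interval le_rfl t.2.1 t.2.2
      (Eventually.of_forall fun x => abs_nonneg _) hint.abs
  rw [h, intervalIntegral.integral_sub
    ((AbsolutelyContinuousOnInterval.intervalIntegrable_deriv f.2.1).mono_set hsub)
    ((AbsolutelyContinuousOnInterval.intervalIntegrable_deriv g.2.1).mono_set hsub),
    hF, hF] at hle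
  exact sub_eq_zero.mp (abs_nonpos_iff.mp hle)

/-- `H₊^{AC}` carries the metric `ρ` and the topology generated by it. -/
noncomputable instance : MetricSpace HplusAC where
  dist := rho
  dist_self f := by simp [rho]
  dist_comm f g := by simp only [rho, abs_sub_comm]
  dist_triangle f g h := by
    unfold rho
    rw [← intervalIntegral.integral_add (intervalIntegrable_sub f g).abs
      (intervalIntegrable_sub g h).abs]
    exact intervalIntegral.integral_mono_on zero_le_one (intervalIntegrable_sub f h).abs
      ((intervalIntegrable_sub f g).abs.add (intervalIntegrable_sub g h).abs)
      (fun x _ => abs_sub_le _ _ _)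
  eq_of_dist_eq_zero := eq_of_rho_eq_zero _ _

/-- `C ∩ N ∩ H₊^{AC}`, as a subset of `H₊^{AC}`. -/
def setCN : Set HplusAC := {f | (f : Hplus) ∈ Hplus.setC ∩ Hplus.setN}

end HplusAC

/-- An element of a topological group is generic if its conjugacy class is comeagre. -/
def IsGenericElement {G : Type*} [Group G] [TopologicalSpace G] (g : G) : Prop :=
  conjugatesOf g ∈ residual G

/-! An element of `HplusAC` is the same thing as an a.e. positive integrable density with integral
1, and `rho` is the `L¹` distance of densities. The admissible densities form a `G_δ` in `L¹`, so
`HplusAC` is a Baire space. An increasing homeomorphism belongs to `HplusAC` exactly when it and its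
inverse preserve null sets (`mem_HplusAC_iff`). This form of absolute continuity survives countable
gluing.

For a homeomorphism with null fixed point set, membership in `C` is equivalent to a local condition,
`IsAlternating`: `f - id` takes positive, negative and positive values in every neighbourhood of
each fixed point. Both this condition and nullity of `Fix` are `G_δ`, by compactness of `I`. Nullity
is dense because along a segment from `f` to some `k` lying above the identity the fixed sets are
disjoint, hence all but countably many are null. Alternation is dense because near a fixed point `f`
can be made equal to the identity on a tiny interval at small cost, and then perturbed there.

Any two elements of `C ∩ N` in `HplusAC` are conjugate (`exists_conj`). A coloured version of
Cantor's back-and-forth argument matches their orbitals, preserving order and parity. On each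
orbital the map is conjugate to a unit translation of `ℝ`, by a bijection preserving null sets both
ways. The resulting identifications glue to a homeomorphism; since the fixed sets are null and there
are countably many orbitals, it and its inverse preserve null sets. So `setCN` is one conjugacy
class and a dense `G_δ`, and by Baire any comeagre class must meet it. -/

/-! ### Absolutely continuous homeomorphisms and their densities -/

namespace Hplus

/-- The derivative of `f`, as a function on `[0,1]`. -/
noncomputable def density (f : Hplus) (x : unitInterval) : ℝ := deriv f.ext x

/-- The measure `E ↦ λ(f(E))`. -/
noncomputable def pull (f : Hplus) : Measure unitInterval :=
  Measure.map f.toHomeomorph.symm.toMeasurableEquiv volume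

theorem pull_apply (f : Hplus) (s : Set unitInterval) : f.pull s = volume (f '' s) := by
  rw [pull, MeasurableEquiv.map_apply]
  congr 1
  exact (f.toEquiv.image_eq_preimage_symm s).symm

instance (f : Hplus) : IsFiniteMeasure f.pull :=
  ⟨by rw [pull_apply]; exact measure_lt_top _ _⟩

theorem pull_Iic (f : Hplus) (x : unitInterval) : f.pull (Iic x) = ENNReal.ofReal (f x) := by
  rw [pull_apply, OrderIso.image_Iic, unitInterval.volume_Iic]

theorem map_zero' (f : Hplus) : f 0 = 0 := f.map_bot

theorem map_one' (f : Hplus) : f 1 = 1 := f.map_top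

end Hplus

theorem integrable_coe_iff_intervalIntegrable {g : ℝ → ℝ} :
    Integrable (fun x : unitInterval => g x) ↔ IntervalIntegrable g volume 0 1 := by
  rw [intervalIntegrable_iff_integrableOn_Icc_of_le zero_le_one, IntegrableOn]
  exact unitInterval.measurePreserving_coe.integrable_comp_emb
    unitInterval.measurableEmbedding_coe

theorem setIntegral_Iic_coe (g : ℝ → ℝ) (x : unitInterval) :
    ∫ y in Iic x, g y = ∫ y in (0 : ℝ)..x, g y := by
  have h := unitInterval.measurePreserving_coe.setIntegral_preimage_emb
    unitInterval.measurableEmbedding_coe g (Iic (x : ℝ))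
  rw [Measure.restrict_restrict measurableSet_Iic] at h
  rw [intervalIntegral.integral_of_le x.2.1, ← integral_Icc_eq_integral_Ioc]
  have h1 : Iic (x : ℝ) ∩ Icc 0 1 = Icc 0 (x : ℝ) := by
    ext y
    simp only [mem_inter_iff, mem_Iic, mem_Icc]
    exact ⟨fun h => ⟨h.2.1, h.1⟩, fun h => ⟨h.2, h.1, h.2.trans x.2.2⟩⟩
  exact h.trans (congrArg (fun s => ∫ t in s, g t) h1)

theorem integral_coe (g : ℝ → ℝ) :
    ∫ y : unitInterval, g y = ∫ y in (0 : ℝ)..1, g y := by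
  have h := setIntegral_Iic_coe g 1
  rwa [show (Iic (1 : unitInterval)) = univ from Iic_top, setIntegral_univ] at h

theorem ofReal_setIntegral_Iic {r : unitInterval → ℝ} (hr : Integrable r) (h0 : 0 ≤ᵐ[volume] r)
    (x : unitInterval) :
    ENNReal.ofReal (∫ y in Iic x, r y) =
      volume.withDensity (fun y => ENNReal.ofReal (r y)) (Iic x) := by
  rw [withDensity_apply _ measurableSet_Iic,
    ofReal_integral_eq_lintegral_ofReal hr.integrableOn (ae_restrict_of_ae h0)]

theorem isFiniteMeasure_withDensity_ofReal' {r : unitInterval → ℝ} (hr : Integrable r) :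
    IsFiniteMeasure (volume.withDensity (fun y => ENNReal.ofReal (r y))) :=
  isFiniteMeasure_withDensity_ofReal hr.2

namespace Hplus

theorem density_nonneg (f : Hplus) (x : unitInterval) : 0 ≤ f.density x :=
  f.ext_monotone.deriv_nonneg

theorem pull_eq_withDensity {f : Hplus} {r : unitInterval → ℝ} (hr : Integrable r)
    (h0 : 0 ≤ᵐ[volume] r) (h : ∀ x, (f x : ℝ) = ∫ y in Iic x, r y) :
    f.pull = volume.withDensity (fun y => ENNReal.ofReal (r y)) := by
  have := isFiniteMeasure_withDensity_ofReal' hr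
  refine Measure.ext_of_Iic _ _ fun x => ?_
  rw [pull_Iic, h, ofReal_setIntegral_Iic hr h0]

theorem IsAC.integrable_density {f : Hplus} (hf : f.IsAC) : Integrable f.density :=
  integrable_coe_iff_intervalIntegrable.2
    (AbsolutelyContinuousOnInterval.intervalIntegrable_deriv hf)

theorem IsAC.eq_setIntegral {f : Hplus} (hf : f.IsAC) (x : unitInterval) :
    (f x : ℝ) = ∫ y in Iic x, f.density y := by
  have hk : AbsolutelyContinuousOnInterval f.ext 0 x := by
    refine AbsolutelyContinuousOnInterval.mono hf ?_
    rw [uIcc_of_le x.2.1, uIcc_of_le zero_le_one]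
    exact Icc_subset_Icc_right x.2.2
  unfold density
  rw [setIntegral_Iic_coe (deriv f.ext), hk.integral_deriv_eq_sub, ext_coe]
  have h1 := f.ext_coe 0
  rw [map_zero'] at h1
  simp only [Icc.coe_zero] at h1
  rw [h1, sub_zero]

theorem IsAC.integral_density {f : Hplus} (hf : f.IsAC) : ∫ y, f.density y = 1 := by
  have h := hf.eq_setIntegral 1
  rw [map_one', show (Iic (1 : unitInterval)) = univ from Iic_top, setIntegral_univ] at h
  exact h.symm

theorem IsAC.pull_eq {f : Hplus} (hf : f.IsAC) :
    f.pull = volume.withDensity (fun y => ENNReal.ofReal (f.density y)) :=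
  pull_eq_withDensity hf.integrable_density (ae_of_all _ f.density_nonneg) hf.eq_setIntegral

theorem IsAC.volume_image_eq_zero {f : Hplus} (hf : f.IsAC) {s : Set unitInterval}
    (hs : volume s = 0) : volume (f '' s) = 0 := by
  rw [← pull_apply, hf.pull_eq]
  exact withDensity_absolutelyContinuous _ _ hs

theorem isAC_of_eq_setIntegral {f : Hplus} {r : unitInterval → ℝ} (hr : Integrable r)
    (h : ∀ x, (f x : ℝ) = ∫ y in Iic x, r y) : f.IsAC := by
  set g : ℝ → ℝ := IccExtend (zero_le_one (α := ℝ)) r with hg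
  have hgr : ∀ x : unitInterval, g x = r x := fun x => IccExtend_val _ _ x
  have hgi : IntervalIntegrable g volume 0 1 := by
    rw [← integrable_coe_iff_intervalIntegrable]
    simpa only [hgr] using hr
  have hac := hgi.absolutelyContinuousOnInterval_intervalIntegral (c := 0) left_mem_uIcc
  have hE : ∀ x ∈ Icc (0 : ℝ) 1, f.ext x = ∫ v in (0 : ℝ)..x, g v := by
    intro x hx
    rw [ext_of_mem _ hx, h, ← setIntegral_Iic_coe g ⟨x, hx⟩]
    simp only [hgr]
  unfold IsAC
  rw [absolutelyContinuousOnInterval_iff] at hac ⊢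
  intro ε hε
  obtain ⟨δ, hδ, h1⟩ := hac ε hε
  refine ⟨δ, hδ, fun E hE' hs => ?_⟩
  refine lt_of_le_of_lt (le_of_eq (Finset.sum_congr rfl fun i hi => ?_)) (h1 E hE' hs)
  have := hE'.1 i hi
  rw [uIcc_of_le zero_le_one] at this
  rw [hE _ this.1, hE _ this.2]

/-- Luzin's condition says that the measure `f.pull` is absolutely continuous, and `f` is then the
primitive of its Radon–Nikodym derivative. -/
theorem isAC_of_volume_image_eq_zero {f : Hplus}
    (hf : ∀ s : Set unitInterval, volume s = 0 → volume (f '' s) = 0) : f.IsAC := by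
  have hac : f.pull ≪ volume := fun s hs => by rw [pull_apply]; exact hf s hs
  refine isAC_of_eq_setIntegral (r := fun x => (f.pull.rnDeriv volume x).toReal)
    Measure.integrable_toReal_rnDeriv fun x => ?_
  rw [Measure.setIntegral_toReal_rnDeriv hac, Measure.real, pull_Iic,
    ENNReal.toReal_ofReal (f x).2.1]

theorem mem_HplusAC_iff {f : Hplus} : f ∈ HplusAC ↔
    (∀ s : Set unitInterval, volume s = 0 → volume (f '' s) = 0) ∧
    (∀ s : Set unitInterval, volume s = 0 → volume (f.symm '' s) = 0) :=
  ⟨fun h => ⟨fun _ hs => h.1.volume_image_eq_zero hs, fun _ hs => h.2.volume_image_eq_zero hs⟩,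
    fun h => ⟨isAC_of_volume_image_eq_zero h.1, isAC_of_volume_image_eq_zero h.2⟩⟩

theorem density_ae_eq {f : Hplus} {r : unitInterval → ℝ} (hr : Integrable r)
    (h0 : 0 ≤ᵐ[volume] r) (h : ∀ x, (f x : ℝ) = ∫ y in Iic x, r y) :
    f.density =ᵐ[volume] r := by
  have hf : f.IsAC := isAC_of_eq_setIntegral hr h
  have h1 := (hf.pull_eq).symm.trans (pull_eq_withDensity hr h0 h)
  have h2 := (withDensity_eq_iff hf.integrable_density.aemeasurable.ennreal_ofReal
    hr.aemeasurable.ennreal_ofReal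
    (by
      have := hf.integrable_density.2
      have h3 := isFiniteMeasure_withDensity_ofReal' hf.integrable_density
      have h4 := h3.measure_univ_lt_top.ne
      rwa [withDensity_apply _ MeasurableSet.univ, Measure.restrict_univ] at h4)).1 h1
  filter_upwards [h2, h0] with x hx hx0
  exact (ENNReal.ofReal_eq_ofReal_iff (f.density_nonneg x) hx0).1 hx

/-- The zero set of the density has null image under `f`; applying `f⁻¹`, which preserves null sets,
shows that it is null itself. -/
theorem density_pos_ae {f : Hplus} (hf : f ∈ HplusAC) : ∀ᵐ x, 0 < f.density x := by
  have hm : AEMeasurable (fun y => ENNReal.ofReal (f.density y)) volume :=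
    hf.1.integrable_density.aemeasurable.ennreal_ofReal
  have h1 : volume.withDensity (fun y => ENNReal.ofReal (f.density y))
      {x | ENNReal.ofReal (f.density x) = 0} = 0 := by
    have := withDensity_apply_eq_zero' (μ := volume) (s := {x | ENNReal.ofReal (f.density x) = 0}) hm
    rw [this]
    convert measure_empty (μ := (volume : Measure unitInterval)) using 2
    ext x
    simp
  rw [← hf.1.pull_eq, pull_apply] at h1
  have h2 := (mem_HplusAC_iff.1 hf).2 _ h1
  rw [OrderIso.symm_image_image] at h2
  rw [ae_iff]
  convert h2 using 3
  ext x
  simp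

/-- Every element needed for the topological part is constructed through its density. Positivity of
`r` gives strict monotonicity of the primitive, and also makes the measure with density `r` have the
same null sets as Lebesgue measure, whence the inverse is absolutely continuous. -/
theorem exists_of_density {r : unitInterval → ℝ} (hr : Integrable r) (h0 : ∀ᵐ x, 0 < r x)
    (h1 : ∫ x, r x = 1) :
    ∃ f : HplusAC, (∀ x, (f.1 x : ℝ) = ∫ y in Iic x, r y) ∧ f.1.density =ᵐ[volume] r := by
  have h0' : 0 ≤ᵐ[volume] r := h0.mono fun x hx => hx.le
  set g : ℝ → ℝ := IccExtend (zero_le_one (α := ℝ)) r with hg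
  have hgr : ∀ x : unitInterval, g x = r x := fun x => IccExtend_val _ _ x
  have hgi : IntervalIntegrable g volume 0 1 := by
    rw [← integrable_coe_iff_intervalIntegrable]
    simpa only [hgr] using hr
  set F : unitInterval → ℝ := fun x => ∫ y in Iic x, r y with hF
  have hFg : ∀ x, F x = ∫ y in (0 : ℝ)..x, g y := fun x => by
    rw [← setIntegral_Iic_coe g x]
    simp only [hgr, hF]
  have hmono : StrictMono F := by
    intro x y hxy
    have hd : Iic y = Iic x ∪ Ioc x y := (Iic_union_Ioc_eq_Iic hxy.le).symm
    have hdis : Disjoint (Iic x) (Ioc x y) := Iic_disjoint_Ioc le_rfl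
    simp only [hF]
    rw [hd, setIntegral_union hdis measurableSet_Ioc hr.integrableOn hr.integrableOn]
    have : 0 < ∫ z in Ioc x y, r z := by
      rw [setIntegral_pos_iff_support_of_nonneg_ae (ae_restrict_of_ae h0') hr.integrableOn]
      have hsup : volume (Function.support r ∩ Ioc x y) = volume (Ioc x y) := by
        refine measure_congr ?_
        filter_upwards [h0] with z hz
        have : z ∈ Function.support r := hz.ne'
        exact propext (and_iff_right this)
      rw [hsup, unitInterval.volume_Ioc]
      simpa using hxy
    linarith
  have hF0 : F 0 = 0 := by rw [hFg]; simp
  have hF1 : F 1 = 1 := by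
    rw [hF]
    simp only [show (Iic (1 : unitInterval)) = univ from Iic_top, setIntegral_univ, h1]
  have hmem : ∀ x, F x ∈ Icc (0 : ℝ) 1 := fun x =>
    ⟨hF0 ▸ hmono.monotone x.2.1, hF1 ▸ hmono.monotone x.2.2⟩
  have hcont : ContinuousOn (fun x : ℝ => ∫ y in (0 : ℝ)..x, g y) (uIcc 0 1) :=
    (hgi.absolutelyContinuousOnInterval_intervalIntegral (c := 0) left_mem_uIcc).continuousOn
  let G : unitInterval → unitInterval := fun x => ⟨F x, hmem x⟩
  have hGmono : StrictMono G := fun x y hxy => hmono hxy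
  have hGsurj : Function.Surjective G := by
    intro y
    have hy : (y : ℝ) ∈ uIcc ((fun x : ℝ => ∫ y in (0 : ℝ)..x, g y) 0)
        ((fun x : ℝ => ∫ y in (0 : ℝ)..x, g y) 1) := by
      have e0 := hFg 0
      have e1 := hFg 1
      simp only [Icc.coe_zero, Icc.coe_one] at e0 e1
      simp only [← e0, ← e1, hF0, hF1]
      rw [uIcc_of_le zero_le_one]
      exact y.2
    obtain ⟨x, hx, hxy⟩ := intermediate_value_uIcc hcont hy
    rw [uIcc_of_le zero_le_one] at hx
    refine ⟨⟨x, hx⟩, Subtype.ext ?_⟩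
    simp only [G]
    rw [hFg]
    exact hxy
  let f : Hplus := hGmono.orderIsoOfSurjective G hGsurj
  have hf : ∀ x, (f x : ℝ) = ∫ y in Iic x, r y := fun x => rfl
  have hfac : f.IsAC := isAC_of_eq_setIntegral hr hf
  have hpull := pull_eq_withDensity hr h0' hf
  have hmemAC : f ∈ HplusAC := by
    refine mem_HplusAC_iff.2 ⟨fun s hs => hfac.volume_image_eq_zero hs, fun s hs => ?_⟩
    have h2 : f.pull (f.symm '' s) = 0 := by
      rw [pull_apply, OrderIso.image_symm_image, hs]
    rw [hpull, withDensity_apply_eq_zero' hr.aemeasurable.ennreal_ofReal] at h2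
    refine measure_mono_null_ae ?_ h2
    filter_upwards [h0] with x hx hxs
    exact ⟨by simpa using hx, hxs⟩
  exact ⟨⟨f, hmemAC⟩, hf, density_ae_eq hr h0' hf⟩

end Hplus

/-! ### The metric as an `L¹` distance -/

namespace HplusAC

theorem dist_eq (f g : HplusAC) : dist f g = ∫ x, |f.1.density x - g.1.density x| :=
  (integral_coe fun x => |deriv f.1.ext x - deriv g.1.ext x|).symm

theorem abs_apply_sub_le_dist (f g : HplusAC) (x : unitInterval) :
    |(f.1 x : ℝ) - g.1 x| ≤ dist f g := by
  have hi := f.2.1.integrable_density.sub g.2.1.integrable_density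
  rw [f.2.1.eq_setIntegral, g.2.1.eq_setIntegral, dist_eq,
    ← integral_sub f.2.1.integrable_density.integrableOn g.2.1.integrable_density.integrableOn]
  exact abs_integral_le_integral_abs.trans
    (setIntegral_le_integral hi.abs (ae_of_all _ fun _ => abs_nonneg _))

/-- The metric dominates the uniform distance, so evaluation is jointly continuous. -/
theorem continuous_apply : Continuous fun p : HplusAC × unitInterval => p.1.1 p.2 := by
  rw [continuous_iff_continuousAt]
  rintro ⟨f, x⟩
  rw [ContinuousAt, nhds_prod_eq, tendsto_subtype_rng]
  have hc : Continuous fun y : unitInterval => (f.1 y : ℝ) :=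
    continuous_subtype_val.comp f.1.continuous
  have h1 : Tendsto (fun p : HplusAC × unitInterval => (f.1 p.2 : ℝ)) (𝓝 f ×ˢ 𝓝 x)
      (𝓝 (f.1 x : ℝ)) := (hc.tendsto x).comp tendsto_snd
  have h2 : Tendsto (fun p : HplusAC × unitInterval => (p.1.1 p.2 : ℝ) - f.1 p.2) (𝓝 f ×ˢ 𝓝 x)
      (𝓝 0) := by
    have h3 : Tendsto (fun g : HplusAC => dist g f) (𝓝 f) (𝓝 0) := by
      have := (continuous_id.dist (continuous_const (y := f))).tendsto f
      simpa only [id, dist_self] using this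
    have h4 : ∀ p : HplusAC × unitInterval, ‖(p.1.1 p.2 : ℝ) - f.1 p.2‖ ≤ dist p.1 f := by
      intro p
      rw [Real.norm_eq_abs]
      exact abs_apply_sub_le_dist p.1 f p.2
    exact squeeze_zero_norm h4 (h3.comp tendsto_fst)
  have h4 := h2.add h1
  simp only [sub_add_cancel, zero_add] at h4
  exact h4

end HplusAC

/-! ### The Baire property -/

theorem IsGδ.baireSpace_of_completeSpace {X : Type*} [MetricSpace X] [CompleteSpace X] {s : Set X}
    (hs : IsGδ s) : BaireSpace s := by
  have : CompleteSpace (closure s) := isClosed_closure.completeSpace_coe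
  have : BaireSpace ((↑) ⁻¹' s : Set (closure s)) :=
    IsGδ.baireSpace_of_dense (hs.preimage continuous_subtype_val) (by
      rw [Subtype.dense_iff]
      intro x hx
      simpa [Subtype.image_preimage_coe, inter_eq_right.2 subset_closure] using hx)
  let e : ((↑) ⁻¹' s : Set (closure s)) ≃ₜ s :=
    { toFun := fun x => ⟨x.1.1, x.2⟩
      invFun := fun x => ⟨⟨x.1, subset_closure x.2⟩, x.2⟩
      left_inv := fun _ => rfl
      right_inv := fun _ => rfl
      continuous_toFun := by fun_prop
      continuous_invFun := by fun_prop }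
  exact e.baireSpace

section PositiveDensities

variable {α : Type*} [MeasurableSpace α] {μ : Measure α} [IsFiniteMeasure μ]

theorem integrable_max_one_sub {r : α → ℝ} (hr : Integrable r μ) (m : ℕ) :
    Integrable (fun x => max (0 : ℝ) (1 - m * r x)) μ := by
  have := ((integrable_const (1 : ℝ)).sub (hr.const_mul (m : ℝ))).pos_part
  exact this.congr (ae_of_all _ fun x => by simp [max_comm])

theorem continuous_integral_max_one_sub (m : ℕ) :
    Continuous fun r : α →₁[μ] ℝ => ∫ x, max (0 : ℝ) (1 - m * r x) ∂μ := by
  refine LipschitzWith.continuous (K := m) (LipschitzWith.of_dist_le_mul fun r s => ?_)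
  have hr := L1.integrable_coeFn r
  have hs := L1.integrable_coeFn s
  rw [Real.dist_eq, ← integral_sub (integrable_max_one_sub hr m) (integrable_max_one_sub hs m),
    dist_eq_norm, L1.norm_eq_integral_norm, NNReal.coe_natCast, ← integral_const_mul]
  refine abs_integral_le_integral_abs.trans (integral_mono_ae
    ((integrable_max_one_sub hr m).sub (integrable_max_one_sub hs m)).abs
    ((L1.integrable_coeFn (r - s)).norm.const_mul _) ?_)
  filter_upwards [Lp.coeFn_sub r s] with x hx
  rw [hx, Pi.sub_apply, Real.norm_eq_abs]
  refine (abs_max_sub_max_le_max _ _ _ _).trans ?_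
  rw [sub_self, abs_zero, max_eq_right (abs_nonneg _), ← abs_of_nonneg (Nat.cast_nonneg (α := ℝ) m),
    ← abs_mul, abs_of_nonneg (Nat.cast_nonneg (α := ℝ) m), ← abs_neg]
  apply le_of_eq
  congr 1
  ring

/-- Positivity a.e. is detected by the functionals `∫ max 0 (1 - m r)`. If `r > 0` a.e. they tend to
0 as `m → ∞`, by dominated convergence. On `{r ≤ 0}` the integrand is at least 1 for every `m`, so
each functional bounds the measure of that set. They are Lipschitz in `r`, so the sublevel sets are
open. -/
theorem isGδ_setOf_ae_pos : IsGδ {r : α →₁[μ] ℝ | ∀ᵐ x ∂μ, 0 < r x} := by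
  have h : {r : α →₁[μ] ℝ | ∀ᵐ x ∂μ, 0 < r x} =
      ⋂ n : ℕ, ⋃ m : ℕ, {r | ∫ x, max (0 : ℝ) (1 - m * r x) ∂μ < 1 / ((n : ℝ) + 1)} := by
    ext r
    have hr := L1.integrable_coeFn r
    simp only [mem_ofPred_eq, mem_iInter, mem_iUnion]
    constructor
    · intro hpos n
      have hlim : Tendsto (fun m : ℕ => ∫ x, max (0 : ℝ) (1 - m * r x) ∂μ) atTop (𝓝 (∫ _, 0 ∂μ)) := by
        refine tendsto_integral_of_dominated_convergence (fun _ => 1)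
          (fun m => (integrable_max_one_sub hr m).aestronglyMeasurable) (integrable_const _)
          (fun m => ?_) ?_
        · filter_upwards [hpos] with x hx
          have : 0 ≤ (m : ℝ) * r x := by positivity
          rw [Real.norm_eq_abs, abs_of_nonneg (le_max_left _ _)]
          exact max_le zero_le_one (by linarith)
        · filter_upwards [hpos] with x hx
          refine tendsto_const_nhds.congr' ?_
          obtain ⟨k, hk⟩ := exists_nat_gt (1 / r x)
          filter_upwards [eventually_ge_atTop k] with m hm
          have h1 : (k : ℝ) ≤ m := by exact_mod_cast hm
          have h2 : 1 < (m : ℝ) * r x := (div_lt_iff₀ hx).1 (hk.trans_le h1)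
          exact (max_eq_left (by linarith)).symm
      rw [integral_zero] at hlim
      exact (hlim.eventually (gt_mem_nhds (by positivity))).exists
    · intro hr'
      have hm : MeasurableSet {x | r x ≤ 0} :=
        measurableSet_le (Lp.stronglyMeasurable r).measurable measurable_const
      rw [ae_iff]
      simp only [not_lt]
      rw [← measureReal_eq_zero_iff]
      refine le_antisymm (le_of_forall_pos_lt_add fun ε hε => ?_) measureReal_nonneg
      obtain ⟨n, hn⟩ := exists_nat_one_div_lt hε
      obtain ⟨m, hm'⟩ := hr' n
      rw [zero_add]
      refine lt_of_le_of_lt ?_ (hm'.trans hn)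
      rw [← integral_indicator_one hm]
      refine integral_mono ((integrable_const (1 : ℝ)).indicator hm) (integrable_max_one_sub hr m)
        fun x => ?_
      by_cases hx : r x ≤ 0
      · rw [indicator_of_mem (by exact hx)]
        have : (m : ℝ) * r x ≤ 0 := mul_nonpos_of_nonneg_of_nonpos (Nat.cast_nonneg m) hx
        exact le_max_of_le_right (by simp only [Pi.one_apply]; linarith)
      · rw [indicator_of_notMem (by exact hx)]
        exact le_max_left _ _
  rw [h]
  refine .iInter fun n => (isOpen_iUnion fun m => ?_).isGδ
  exact isOpen_lt (continuous_integral_max_one_sub m) continuous_const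

end PositiveDensities

namespace HplusAC

/-- The derivative of an element of `H₊^{AC}` as an element of `L¹`. -/
noncomputable def toL1 (f : HplusAC) : unitInterval →₁[volume] ℝ :=
  f.2.1.integrable_density.toL1 _

theorem isometry_toL1 : Isometry toL1 := by
  refine Isometry.of_dist_eq fun f g => ?_
  rw [dist_eq, toL1, toL1, dist_eq_norm, ← Integrable.toL1_sub, L1.norm_of_fun_eq_integral_norm]
  rfl

theorem range_toL1 : range toL1 =
    {r | ∀ᵐ x, 0 < r x} ∩ {r | ∫ x, r x = 1} := by
  ext r
  constructor
  · rintro ⟨f, rfl⟩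
    have h := f.2.1.integrable_density.coeFn_toL1
    refine ⟨?_, ?_⟩
    · filter_upwards [h, Hplus.density_pos_ae f.2] with x hx hx'
      rwa [toL1, hx]
    · exact (integral_congr_ae h).trans f.2.1.integral_density
  · rintro ⟨h1, h2⟩
    obtain ⟨f, -, hf⟩ := Hplus.exists_of_density (L1.integrable_coeFn r) h1 h2
    refine ⟨f, ?_⟩
    rw [toL1, ← Integrable.toL1_coeFn r (L1.integrable_coeFn r)]
    exact (Integrable.toL1_eq_toL1_iff _ _ _ _).2 hf

instance : BaireSpace HplusAC := by
  have h : IsGδ (range toL1) := by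
    rw [range_toL1]
    exact isGδ_setOf_ae_pos.inter (isClosed_eq continuous_integral continuous_const).isGδ
  have := h.baireSpace_of_completeSpace
  exact isometry_toL1.isEmbedding.toHomeomorph.symm.baireSpace

end HplusAC

/-! ### Fixed points, orbitals and descriptions of `C ∩ N` -/

namespace Hplus

/-- There is a fixed point of `f` strictly between `x` and `y`. -/
def Separated (f : Hplus) (x y : unitInterval) : Prop := ∃ w, x < w ∧ w < y ∧ f w = w

/-- Every neighbourhood of a fixed point of `f` contains three points `x₁ < x₂ < x₃` at which
`f - id` is positive, negative and positive, respectively. -/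
def IsAlternating (f : Hplus) : Prop :=
  ∀ z, f z = z → ∀ U ∈ 𝓝 z, ∃ x₁ ∈ U, ∃ x₂ ∈ U, ∃ x₃ ∈ U,
    x₁ < x₂ ∧ x₂ < x₃ ∧ x₁ < f x₁ ∧ f x₂ < x₂ ∧ x₃ < f x₃

theorem exists_fixed_of_lt_of_gt {f : Hplus} {x y : unitInterval} (hxy : x < y)
    (hx : x < f x) (hy : f y < y) : f.Separated x y := by
  obtain ⟨w, hw, h⟩ := isPreconnected_Icc.intermediate_value₂ (left_mem_Icc.2 hxy.le)
    (right_mem_Icc.2 hxy.le) continuousOn_id f.continuous.continuousOn hx.le hy.le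
  have h' : f w = w := h.symm
  refine ⟨w, lt_of_le_of_ne hw.1 ?_, lt_of_le_of_ne hw.2 ?_, h'⟩ <;> rintro rfl
  · exact hx.ne' h'
  · exact hy.ne h'

theorem exists_fixed_of_gt_of_lt {f : Hplus} {x y : unitInterval} (hxy : x < y)
    (hx : f x < x) (hy : y < f y) : f.Separated x y := by
  obtain ⟨w, hw, h⟩ := isPreconnected_Icc.intermediate_value₂ (left_mem_Icc.2 hxy.le)
    (right_mem_Icc.2 hxy.le) f.continuous.continuousOn continuousOn_id hx.le hy.le
  have h' : f w = w := h
  refine ⟨w, lt_of_le_of_ne hw.1 ?_, lt_of_le_of_ne hw.2 ?_, h'⟩ <;> rintro rfl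
  · exact hx.ne h'
  · exact hy.ne' h'

theorem isClosed_Fix (f : Hplus) : IsClosed f.Fix := isClosed_eq f.continuous continuous_id

theorem exists_component (f : Hplus) {x : unitInterval} (hx : f x ≠ x) :
    ∃ a b, a < x ∧ x < b ∧ f a = a ∧ f b = b ∧ ∀ z ∈ Ioo a b, f z ≠ z := by
  obtain ⟨a, ⟨ha, hax⟩, ha'⟩ := (f.isClosed_Fix.inter isClosed_Iic).isCompact.exists_isGreatest
    (⟨0, f.map_zero', x.2.1⟩ : (f.Fix ∩ Iic x).Nonempty)
  obtain ⟨b, ⟨hb, hxb⟩, hb'⟩ := (f.isClosed_Fix.inter isClosed_Ici).isCompact.exists_isLeast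
    (⟨1, f.map_one', x.2.2⟩ : (f.Fix ∩ Ici x).Nonempty)
  refine ⟨a, b, lt_of_le_of_ne hax ?_, lt_of_le_of_ne hxb ?_, ha, hb, fun z hz h => ?_⟩
  · rintro rfl; exact hx ha
  · rintro rfl; exact hx hb
  · rcases le_total z x with hzx | hzx
    · exact not_le.2 hz.1 (ha' ⟨h, hzx⟩)
    · exact not_le.2 hz.2 (hb' ⟨h, hzx⟩)

theorem orbital_eq_Ioo {f : Hplus} {a b x : unitInterval} (ha : f a = a) (hb : f b = b)
    (h : ∀ z ∈ Ioo a b, f z ≠ z) (hx : x ∈ Ioo a b) : f.orbital x = Ioo a b := by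
  have hxF : x ∈ f.Fixᶜ := h x hx
  rw [orbital, if_neg hxF]
  refine Subset.antisymm ?_ (isPreconnected_Ioo.subset_connectedComponentIn hx fun z hz => h z hz)
  have hoc := (isPreconnected_connectedComponentIn (F := f.Fixᶜ) (x := x)).ordConnected
  have hxc := mem_connectedComponentIn hxF
  have hsub := connectedComponentIn_subset f.Fixᶜ x
  intro y hy
  refine ⟨lt_of_not_ge fun hya => ?_, lt_of_not_ge fun hby => ?_⟩
  · exact hsub (hoc.out hy hxc ⟨hya, hx.1.le⟩) ha
  · exact hsub (hoc.out hxc hy ⟨hx.2.le, hby⟩) hb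

theorem mem_orbital (f : Hplus) {x : unitInterval} (hx : f x ≠ x) : x ∈ f.orbital x := by
  obtain ⟨a, b, hax, hxb, ha, hb, h⟩ := f.exists_component hx
  rw [orbital_eq_Ioo ha hb h ⟨hax, hxb⟩]
  exact ⟨hax, hxb⟩

/-- Orbitals are the gaps between fixed points, so their order can be tested on representatives.
From here on, conditions on orbitals become conditions on points. -/
theorem precedes_orbital_iff {f : Hplus} {x y : unitInterval} (hx : f x ≠ x) (hy : f y ≠ y) :
    Precedes (f.orbital x) (f.orbital y) ↔ f.Separated x y := by
  obtain ⟨a, b, hax, hxb, ha, hb, h⟩ := f.exists_component hx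
  obtain ⟨c, d, hcy, hyd, hc, hd, h'⟩ := f.exists_component hy
  rw [orbital_eq_Ioo ha hb h ⟨hax, hxb⟩, orbital_eq_Ioo hc hd h' ⟨hcy, hyd⟩]
  constructor
  · intro hp
    refine ⟨b, hxb, lt_of_not_ge fun hyb => ?_, hb⟩
    have hxy := hp x ⟨hax, hxb⟩ y ⟨hcy, hyd⟩
    have hyb' : y < b := lt_of_le_of_ne hyb (by rintro rfl; exact hy hb)
    exact lt_irrefl _ (hp y ⟨hax.trans hxy, hyb'⟩ y ⟨hcy, hyd⟩)
  · rintro ⟨w, hxw, hwy, hw⟩ u hu v hv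
    have h1 : b ≤ w := le_of_not_gt fun hwb => h w ⟨hax.trans hxw, hwb⟩ hw
    have h2 : w ≤ c := le_of_not_gt fun hcw => h' w ⟨hcw, hwy.trans hyd⟩ hw
    exact hu.2.trans_le (h1.trans (h2.trans hv.1.le))

theorem orbital_eq_of_not_separated {f : Hplus} {x y : unitInterval} (hx : f x ≠ x)
    (h1 : ¬ f.Separated x y) (h2 : ¬ f.Separated y x) (hy : f y ≠ y) :
    f.orbital x = f.orbital y := by
  obtain ⟨a, b, hax, hxb, ha, hb, h⟩ := f.exists_component hx
  have hay : a < y := lt_of_not_ge fun hya =>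
    h2 ⟨a, lt_of_le_of_ne hya (by rintro rfl; exact hy ha), hax, ha⟩
  have hyb : y < b := lt_of_not_ge fun hby =>
    h1 ⟨b, hxb, lt_of_le_of_ne hby (by rintro rfl; exact hy hb), hb⟩
  rw [orbital_eq_Ioo ha hb h ⟨hax, hxb⟩, orbital_eq_Ioo ha hb h ⟨hay, hyb⟩]

theorem Separated.lt {f : Hplus} {x y : unitInterval} (h : f.Separated x y) : x < y := by
  obtain ⟨w, h1, h2, -⟩ := h
  exact h1.trans h2

theorem Separated.trans {f : Hplus} {x y z : unitInterval} (h : f.Separated x y)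
    (h' : f.Separated y z) : f.Separated x z := by
  obtain ⟨w, h1, h2, h3⟩ := h
  exact ⟨w, h1, h2.trans h'.lt, h3⟩

/-- The order-theoretic condition defining the set `C`, in terms of points instead of orbitals. -/
structure IsDenselyColored (f : Hplus) : Prop where
  nonempty : ∃ x, f x ≠ x
  exists_left : ∀ x, f x ≠ x → ∃ v, f v ≠ v ∧ f.Separated v x
  exists_right : ∀ x, f x ≠ x → ∃ v, f v ≠ v ∧ f.Separated x v
  exists_pos : ∀ x y, f x ≠ x → f y ≠ y → f.Separated x y →
    ∃ v, f.Separated x v ∧ f.Separated v y ∧ v < f v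
  exists_neg : ∀ x y, f x ≠ x → f y ≠ y → f.Separated x y →
    ∃ v, f.Separated x v ∧ f.Separated v y ∧ f v < v

theorem mem_setC_iff {f : Hplus} : f ∈ setC ↔ f.IsDenselyColored := by
  constructor
  · rintro ⟨⟨_, x, hx, rfl⟩, -, -, hl, hr, hp, hn⟩
    refine ⟨⟨x, hx⟩, fun x hx => ?_, fun x hx => ?_, fun x y hx hy hxy => ?_,
      fun x y hx hy hxy => ?_⟩
    · obtain ⟨_, ⟨v, hv, rfl⟩, h⟩ := hl _ ⟨x, hx, rfl⟩
      exact ⟨v, hv, (precedes_orbital_iff hv hx).1 h⟩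
    · obtain ⟨_, ⟨v, hv, rfl⟩, h⟩ := hr _ ⟨x, hx, rfl⟩
      exact ⟨v, hv, (precedes_orbital_iff hx hv).1 h⟩
    · obtain ⟨_, ⟨v, hv, rfl⟩, h, h'⟩ := hp _ ⟨x, hx, rfl⟩ _ ⟨y, hy, rfl⟩
        ((precedes_orbital_iff hx hy).2 hxy)
      exact ⟨v, (precedes_orbital_iff hx hv.ne').1 h, (precedes_orbital_iff hv.ne' hy).1 h', hv⟩
    · obtain ⟨_, ⟨v, hv, rfl⟩, h, h'⟩ := hn _ ⟨x, hx, rfl⟩ _ ⟨y, hy, rfl⟩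
        ((precedes_orbital_iff hx hy).2 hxy)
      exact ⟨v, (precedes_orbital_iff hx hv.ne).1 h, (precedes_orbital_iff hv.ne hy).1 h', hv⟩
  · intro hf
    have hpos : ∀ J ∈ f.nonzeroOrbitals, ∀ K ∈ f.nonzeroOrbitals, Precedes J K →
        ∃ L ∈ f.positiveOrbitals, Precedes J L ∧ Precedes L K := by
      rintro _ ⟨x, hx, rfl⟩ _ ⟨y, hy, rfl⟩ h
      obtain ⟨v, h1, h2, hv⟩ := hf.exists_pos x y hx hy ((precedes_orbital_iff hx hy).1 h)
      exact ⟨_, ⟨v, hv, rfl⟩, (precedes_orbital_iff hx hv.ne').2 h1,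
        (precedes_orbital_iff hv.ne' hy).2 h2⟩
    refine ⟨?_, ?_, ?_, ?_, ?_, hpos, ?_⟩
    · obtain ⟨x, hx⟩ := hf.nonempty
      exact ⟨_, x, hx, rfl⟩
    · refine { trichotomous := ?_, irrefl := ?_, trans := ?_ }
      · rintro ⟨_, x, hx, rfl⟩ ⟨_, y, hy, rfl⟩ h1 h2
        simp only [precedes_orbital_iff hx hy, precedes_orbital_iff hy hx] at h1 h2
        exact Subtype.ext (orbital_eq_of_not_separated hx h1 h2 hy)
      · rintro ⟨_, x, hx, rfl⟩ h
        exact ((precedes_orbital_iff hx hx).1 h).lt.false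
      · rintro ⟨_, x, hx, rfl⟩ ⟨_, y, hy, rfl⟩ ⟨_, z, hz, rfl⟩ h1 h2
        exact (precedes_orbital_iff hx hz).2
          (((precedes_orbital_iff hx hy).1 h1).trans ((precedes_orbital_iff hy hz).1 h2))
    · intro J hJ K hK h
      obtain ⟨_, ⟨v, hv, rfl⟩, h'⟩ := hpos J hJ K hK h
      exact ⟨_, ⟨v, hv.ne', rfl⟩, h'⟩
    · rintro _ ⟨x, hx, rfl⟩
      obtain ⟨v, hv, h⟩ := hf.exists_left x hx
      exact ⟨_, ⟨v, hv, rfl⟩, (precedes_orbital_iff hv hx).2 h⟩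
    · rintro _ ⟨x, hx, rfl⟩
      obtain ⟨v, hv, h⟩ := hf.exists_right x hx
      exact ⟨_, ⟨v, hv, rfl⟩, (precedes_orbital_iff hx hv).2 h⟩
    · rintro _ ⟨x, hx, rfl⟩ _ ⟨y, hy, rfl⟩ h
      obtain ⟨v, h1, h2, hv⟩ := hf.exists_neg x y hx hy ((precedes_orbital_iff hx hy).1 h)
      exact ⟨_, ⟨v, hv, rfl⟩, (precedes_orbital_iff hx hv.ne).2 h1,
        (precedes_orbital_iff hv.ne hy).2 h2⟩

theorem mem_setN_iff {f : Hplus} : f ∈ setN ↔ volume f.Fix = 0 := by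
  rw [unitInterval.volume_apply]
  rfl

theorem exists_not_fixed {f : Hplus} (hf : volume f.Fix = 0) {x y : unitInterval} (h : x < y) :
    ∃ v, x < v ∧ v < y ∧ f v ≠ v := by
  by_contra! hc
  have h1 : volume (Ioo x y) ≤ volume f.Fix := measure_mono fun v hv => hc v hv.1 hv.2
  rw [hf, unitInterval.volume_Ioo] at h1
  have h2 : (x : ℝ) < y := h
  have h3 := ENNReal.ofReal_eq_zero.1 (le_zero_iff.1 h1)
  linarith

theorem IsAlternating.exists_fixed_pair {f : Hplus} (hf : f.IsAlternating) {z : unitInterval}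
    (hz : f z = z) {U : Set unitInterval} (hU : U ∈ 𝓝 z) :
    ∃ x₁ ∈ U, ∃ x₂ ∈ U, ∃ x₃ ∈ U, x₁ < f x₁ ∧ f x₂ < x₂ ∧ x₃ < f x₃ ∧
      ∃ w₁ w₂, x₁ < w₁ ∧ w₁ < x₂ ∧ x₂ < w₂ ∧ w₂ < x₃ ∧ f w₁ = w₁ ∧ f w₂ = w₂ := by
  obtain ⟨x₁, h1, x₂, h2, x₃, h3, h12, h23, p1, p2, p3⟩ := hf z hz U hU
  obtain ⟨w₁, a1, a2, a3⟩ := exists_fixed_of_lt_of_gt h12 p1 p2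
  obtain ⟨w₂, b1, b2, b3⟩ := exists_fixed_of_gt_of_lt h23 p2 p3
  exact ⟨x₁, h1, x₂, h2, x₃, h3, p1, p2, p3, w₁, w₂, a1, a2, b1, b2, a3, b3⟩

theorem IsAlternating.isDenselyColored {f : Hplus} (hf : f.IsAlternating) :
    f.IsDenselyColored := by
  have key : ∀ x y, f x ≠ x → f y ≠ y → f.Separated x y →
      ∃ u v, f.Separated x u ∧ f.Separated u y ∧ u < f u ∧
        f.Separated x v ∧ f.Separated v y ∧ f v < v := by
    rintro x y hx hy ⟨w, hxw, hwy, hw⟩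
    obtain ⟨a, b, hax, hxb, ha, hb, h⟩ := f.exists_component hx
    obtain ⟨c, d, hcy, hyd, hc, hd, h'⟩ := f.exists_component hy
    have h1 : b ≤ w := le_of_not_gt fun hwb => h w ⟨hax.trans hxw, hwb⟩ hw
    have h2 : w ≤ c := le_of_not_gt fun hcw => h' w ⟨hcw, hwy.trans hyd⟩ hw
    -- Two components cannot share the endpoint `b`: alternation at `b` would yield fixed points `w₁
    -- < w₂` with `b ≤ w₁`, putting `w₂` inside the right-hand component.
    have hbc : b ≠ c := by
      rintro rfl
      obtain ⟨x₁, m1, x₂, m2, x₃, m3, p1, p2, p3, w₁, w₂, a1, a2, b1, b2, e1, e2⟩ :=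
        hf.exists_fixed_pair hb (Ioo_mem_nhds (hax.trans hxb) (hcy.trans hyd))
      have h3 : b ≤ w₁ := le_of_not_gt fun hw => h _ ⟨m1.1.trans a1, hw⟩ e1
      exact h' w₂ ⟨h3.trans_lt (a2.trans b1), b2.trans m3.2⟩ e2
    have hbc' : b < c := lt_of_le_of_ne (h1.trans h2) hbc
    obtain ⟨x₁, m1, x₂, m2, x₃, m3, p1, p2, p3, w₁, w₂, a1, a2, b1, b2, e1, e2⟩ :=
      hf.exists_fixed_pair hb (Ioo_mem_nhds (hax.trans hxb) hbc')
    have h3 : b ≤ w₁ := le_of_not_gt fun hw => h _ ⟨m1.1.trans a1, hw⟩ e1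
    -- The fixed point `w₂` lies strictly inside `(b, c)`. Alternation there gives points of both
    -- parities in `(b, c)`, and the fixed endpoints `b` and `c` separate them from `x` and `y`.
    obtain ⟨u, hu, v, hv, -, -, -, -, p1', p2', -⟩ :=
      hf w₂ e2 (Ioo b c) (Ioo_mem_nhds (h3.trans_lt (a2.trans b1)) (b2.trans m3.2))
    exact ⟨u, v, ⟨b, hxb, hu.1, hb⟩, ⟨c, hu.2, hcy, hc⟩, p1', ⟨b, hxb, hv.1, hb⟩,
      ⟨c, hv.2, hcy, hc⟩, p2'⟩
  refine ⟨?_, fun x hx => ?_, fun x hx => ?_, fun x y hx hy hxy => ?_, fun x y hx hy hxy => ?_⟩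
  · obtain ⟨x, -, -, -, -, -, -, -, h, -⟩ := hf 0 f.map_zero' univ univ_mem
    exact ⟨x, h.ne'⟩
  · obtain ⟨a, b, hax, hxb, ha, hb, h⟩ := f.exists_component hx
    obtain ⟨x₁, m1, x₂, m2, x₃, m3, p1, p2, p3, w₁, w₂, a1, a2, b1, b2, e1, e2⟩ :=
      hf.exists_fixed_pair ha (Iio_mem_nhds (hax.trans hxb))
    have h1 : w₁ ≤ a := le_of_not_gt fun hw => h _ ⟨hw, a2.trans m2⟩ e1
    exact ⟨x₁, p1.ne', w₁, a1, h1.trans_lt hax, e1⟩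
  · obtain ⟨a, b, hax, hxb, ha, hb, h⟩ := f.exists_component hx
    obtain ⟨x₁, m1, x₂, m2, x₃, m3, p1, p2, p3, w₁, w₂, a1, a2, b1, b2, e1, e2⟩ :=
      hf.exists_fixed_pair hb (Ioi_mem_nhds (hax.trans hxb))
    have h1 : b ≤ w₂ := le_of_not_gt fun hw => h _ ⟨lt_trans m2 b1, hw⟩ e2
    exact ⟨x₃, p3.ne', w₂, hxb.trans_le h1, b2, e2⟩
  · obtain ⟨u, v, h1, h2, h3, -⟩ := key x y hx hy hxy
    exact ⟨u, h1, h2, h3⟩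
  · obtain ⟨u, v, -, -, -, h1, h2, h3⟩ := key x y hx hy hxy
    exact ⟨v, h1, h2, h3⟩

/-- A null fixed set contains no interval, so there are moved points arbitrarily close to `z` on
either side, and `z` separates them. At the endpoints 0 and 1 the second moved point comes from the
absence of a first or last orbital. Density of the two parities then supplies the pattern between
these points. -/
theorem IsDenselyColored.isAlternating {f : Hplus} (hf : f.IsDenselyColored)
    (hN : volume f.Fix = 0) : f.IsAlternating := by
  intro z hz U hU
  obtain ⟨x, y, hx, hy, hxy, hsub⟩ :
      ∃ x y, f x ≠ x ∧ f y ≠ y ∧ f.Separated x y ∧ Icc x y ⊆ U := by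
    rcases eq_or_ne z 0 with rfl | hz0
    · obtain ⟨u, hu, hsub⟩ := exists_Ico_subset_of_mem_nhds hU ⟨1, zero_lt_one⟩
      obtain ⟨y, hy0, hyu, hy⟩ := exists_not_fixed hN hu
      obtain ⟨x, hx, hxy⟩ := hf.exists_left y hy
      exact ⟨x, y, hx, hy, hxy, fun v hv => hsub ⟨v.2.1, hv.2.trans_lt hyu⟩⟩
    rcases eq_or_ne z 1 with rfl | hz1
    · obtain ⟨u, hu, hsub⟩ := exists_Ioc_subset_of_mem_nhds hU ⟨0, zero_lt_one⟩
      obtain ⟨y, hy0, hyu, hy⟩ := exists_not_fixed hN hu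
      obtain ⟨x, hx, hxy⟩ := hf.exists_right y hy
      exact ⟨y, x, hy, hx, hxy, fun v hv => hsub ⟨hy0.trans_le hv.1, v.2.2⟩⟩
    · obtain ⟨l, u, hlu, hsub⟩ := (mem_nhds_iff_exists_Ioo_subset'
        ⟨0, unitInterval.pos_iff_ne_zero.2 hz0⟩ ⟨1, unitInterval.lt_one_iff_ne_one.2 hz1⟩).1 hU
      obtain ⟨x, hlx, hxz, hx⟩ := exists_not_fixed hN hlu.1
      obtain ⟨y, hzy, hyu, hy⟩ := exists_not_fixed hN hlu.2
      exact ⟨x, y, hx, hy, ⟨z, hxz, hzy, hz⟩,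
        fun v hv => hsub ⟨hlx.trans_le hv.1, hv.2.trans_lt hyu⟩⟩
  obtain ⟨v₁, a1, b1, p1⟩ := hf.exists_pos x y hx hy hxy
  obtain ⟨v₂, a2, b2, p2⟩ := hf.exists_neg v₁ y p1.ne' hy b1
  obtain ⟨v₃, a3, b3, p3⟩ := hf.exists_pos v₂ y p2.ne hy b2
  exact ⟨v₁, hsub ⟨a1.lt.le, b1.lt.le⟩, v₂, hsub ⟨(a1.trans a2).lt.le, b2.lt.le⟩,
    v₃, hsub ⟨((a1.trans a2).trans a3).lt.le, b3.lt.le⟩, a2.lt, a3.lt, p1, p2, p3⟩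

/-- This trades the order type of the orbitals for a local condition, whose genericity is accessible
and which is visibly invariant under conjugation. -/
theorem mem_setC_inter_setN_iff {f : Hplus} :
    f ∈ setC ∩ setN ↔ f.IsAlternating ∧ volume f.Fix = 0 := by
  rw [mem_inter_iff, mem_setC_iff, mem_setN_iff]
  exact ⟨fun h => ⟨h.1.isAlternating h.2, h.2⟩, fun h => ⟨h.1.isDenselyColored, h.2⟩⟩

theorem eq_of_Ioo_mem_nonzeroOrbitals {f : Hplus} {a b : unitInterval}
    (h : Ioo a b ∈ f.nonzeroOrbitals) :
    f a = a ∧ f b = b ∧ (∀ z ∈ Ioo a b, f z ≠ z) ∧ ∃ x, a < x ∧ x < b := by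
  obtain ⟨x, hx, he⟩ := h
  have hxm : x ∈ Ioo a b := he ▸ f.mem_orbital hx
  obtain ⟨a', b', hax, hxb, ha, hb, h⟩ := f.exists_component hx
  rw [orbital_eq_Ioo ha hb h ⟨hax, hxb⟩] at he
  have h1 : a = a' := by
    rw [← csInf_Ioo (hxm.1.trans hxm.2), he, csInf_Ioo (hax.trans hxb)]
  have h2 : b = b' := by
    rw [← csSup_Ioo (hxm.1.trans hxm.2), he, csSup_Ioo (hax.trans hxb)]
  subst h1 h2
  exact ⟨ha, hb, h, x, hxm⟩

theorem Ioo_mem_nonzeroOrbitals {f : Hplus} {a b x : unitInterval} (ha : f a = a) (hb : f b = b)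
    (h : ∀ z ∈ Ioo a b, f z ≠ z) (hax : a < x) (hxb : x < b) : Ioo a b ∈ f.nonzeroOrbitals :=
  ⟨x, h x ⟨hax, hxb⟩, (orbital_eq_Ioo ha hb h ⟨hax, hxb⟩).symm⟩

/-- A null set contains no interval, hence is totally disconnected. Absence of isolated fixed points
prevents two components from sharing an endpoint, so that (ii) applies to any two separated
orbitals. Together with nullity it also excludes a first or last orbital: fixed points accumulate at
the outer endpoint of a component, and moved points lie between them. -/
theorem mem_setC_inter_setN_iff_isTotallyDisconnected {f : Hplus} :
    f ∈ setC ∩ setN ↔ (IsTotallyDisconnected f.Fix ∧ Preperfect f.Fix) ∧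
      (∀ a b c d : unitInterval, Ioo a b ∈ f.nonzeroOrbitals → Ioo c d ∈ f.nonzeroOrbitals →
        b < c → ∃ x ∈ Ioo b c, ∃ y ∈ Ioo b c, f x < x ∧ y < f y) ∧
      volume ((fun x : unitInterval => (x : ℝ)) '' f.Fix) = 0 := by
  constructor
  · intro hf
    have hN := hf.2
    rw [mem_setC_inter_setN_iff] at hf
    have hC := hf.1.isDenselyColored
    refine ⟨⟨?_, ?_⟩, ?_, hN⟩
    · intro t ht hpre x hx y hy
      by_contra hxy
      wlog hlt : x < y generalizing x y
      · exact this hy hx (Ne.symm hxy) (lt_of_le_of_ne (not_lt.1 hlt) (Ne.symm hxy))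
      obtain ⟨v, h1, h2, h3⟩ := exists_not_fixed hf.2 hlt
      exact h3 (ht (hpre.ordConnected.out hx hy ⟨h1.le, h2.le⟩))
    · intro z hz
      rw [accPt_iff_nhds]
      intro U hU
      obtain ⟨V, hV, hVU, hVc⟩ : ∃ V ∈ 𝓝 z, V ⊆ U ∧ V.OrdConnected := by
        obtain ⟨a, b, hab, hn, hs⟩ := exists_Icc_mem_subset_of_mem_nhds hU
        exact ⟨Icc a b, hn, hs, ordConnected_Icc⟩
      obtain ⟨x₁, m1, x₂, m2, x₃, m3, p1, p2, p3, w₁, w₂, a1, a2, b1, b2, e1, e2⟩ :=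
        hf.1.exists_fixed_pair hz hV
      rcases eq_or_ne w₁ z with rfl | hne
      · exact ⟨w₂, ⟨hVU (hVc.out m2 m3 ⟨b1.le, b2.le⟩), e2⟩, (a2.trans b1).ne'⟩
      · exact ⟨w₁, ⟨hVU (hVc.out m1 m2 ⟨a1.le, a2.le⟩), e1⟩, hne⟩
    · intro a b c d hab hcd hbc
      obtain ⟨ha, hb, h, x, hax, hxb⟩ := eq_of_Ioo_mem_nonzeroOrbitals hab
      obtain ⟨hc, hd, h', y, hcy, hyd⟩ := eq_of_Ioo_mem_nonzeroOrbitals hcd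
      have key : ∀ v, f.Separated x v → f.Separated v y → v ∈ Ioo b c := by
        rintro v ⟨w₁, h1, h2, h3⟩ ⟨w₂, h4, h5, h6⟩
        exact ⟨(le_of_not_gt fun hw => h w₁ ⟨hax.trans h1, hw⟩ h3).trans_lt h2,
          h4.trans_le (le_of_not_gt fun hw => h' w₂ ⟨hw, h5.trans hyd⟩ h6)⟩
      have hxy : f.Separated x y := ⟨b, hxb, hbc.trans hcy, hb⟩
      obtain ⟨u, u1, u2, u3⟩ := hC.exists_neg x y (h x ⟨hax, hxb⟩) (h' y ⟨hcy, hyd⟩) hxy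
      obtain ⟨v, v1, v2, v3⟩ := hC.exists_pos x y (h x ⟨hax, hxb⟩) (h' y ⟨hcy, hyd⟩) hxy
      exact ⟨u, key u u1 u2, v, key v v1 v2, u3, v3⟩
  · rintro ⟨⟨-, hP⟩, h2, hN⟩
    refine ⟨mem_setC_iff.2 ?_, hN⟩
    have hN' := mem_setN_iff.1 hN
    have hacc : ∀ z, f z = z → ∀ U ∈ 𝓝 z, ∃ w ∈ U, f w = w ∧ w ≠ z := by
      intro z hz U hU
      obtain ⟨w, hw, hne⟩ := accPt_iff_nhds.1 (hP z hz) U hU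
      exact ⟨w, hw.1, hw.2, hne⟩
    have key : ∀ x y, f x ≠ x → f y ≠ y → f.Separated x y →
        ∃ u v, f.Separated x u ∧ f.Separated u y ∧ u < f u ∧
          f.Separated x v ∧ f.Separated v y ∧ f v < v := by
      rintro x y hx hy ⟨w, hxw, hwy, hw⟩
      obtain ⟨a, b, hax, hxb, ha, hb, h⟩ := f.exists_component hx
      obtain ⟨c, d, hcy, hyd, hc, hd, h'⟩ := f.exists_component hy
      have h1 : b ≤ w := le_of_not_gt fun hwb => h w ⟨hax.trans hxw, hwb⟩ hw
      have h3 : w ≤ c := le_of_not_gt fun hcw => h' w ⟨hcw, hwy.trans hyd⟩ hw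
      have hbc : b ≠ c := by
        rintro rfl
        obtain ⟨w, hwU, hw, hne⟩ := hacc b hb _ (Ioo_mem_nhds (hax.trans hxb) (hcy.trans hyd))
        rcases lt_or_gt_of_ne hne with hlt | hlt
        · exact h w ⟨hwU.1, hlt⟩ hw
        · exact h' w ⟨hlt, hwU.2⟩ hw
      obtain ⟨v, hv, u, hu, hv', hu'⟩ := h2 a b c d (Ioo_mem_nonzeroOrbitals ha hb h hax hxb)
        (Ioo_mem_nonzeroOrbitals hc hd h' hcy hyd) (lt_of_le_of_ne (h1.trans h3) hbc)
      exact ⟨u, v, ⟨b, hxb, hu.1, hb⟩, ⟨c, hu.2, hcy, hc⟩, hu', ⟨b, hxb, hv.1, hb⟩,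
        ⟨c, hv.2, hcy, hc⟩, hv'⟩
    refine ⟨?_, fun x hx => ?_, fun x hx => ?_, fun x y hx hy hxy => ?_,
      fun x y hx hy hxy => ?_⟩
    · obtain ⟨v, -, -, hv⟩ := exists_not_fixed hN' (zero_lt_one (α := unitInterval))
      exact ⟨v, hv⟩
    · obtain ⟨a, b, hax, hxb, ha, hb, h⟩ := f.exists_component hx
      obtain ⟨w, hwU, hw, hne⟩ := hacc a ha _ (Iio_mem_nhds (hax.trans hxb))
      have hwa : w < a := lt_of_le_of_ne (le_of_not_gt fun h' => h w ⟨h', hwU⟩ hw) hne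
      obtain ⟨v, -, h4, h5⟩ := exists_not_fixed hN' hwa
      exact ⟨v, h5, a, h4, hax, ha⟩
    · obtain ⟨a, b, hax, hxb, ha, hb, h⟩ := f.exists_component hx
      obtain ⟨w, hwU, hw, hne⟩ := hacc b hb _ (Ioi_mem_nhds (hax.trans hxb))
      have hwa : b < w := lt_of_le_of_ne (le_of_not_gt fun h' => h w ⟨hwU, h'⟩ hw) hne.symm
      obtain ⟨v, h4, -, h5⟩ := exists_not_fixed hN' hwa
      exact ⟨v, h5, b, hxb, h4, hb⟩
    · obtain ⟨u, v, h1, h2, h3, -⟩ := key x y hx hy hxy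
      exact ⟨u, h1, h2, h3⟩
    · obtain ⟨u, v, -, -, -, h1, h2, h3⟩ := key x y hx hy hxy
      exact ⟨v, h1, h2, h3⟩

end Hplus

/-! ### `setCN` is a `G_δ` -/

namespace HplusAC

/-- Projection along the compact factor `I` is a closed map. -/
theorem isOpen_forall_of_isClosed {S : Set (HplusAC × unitInterval)} (hS : IsClosed S) :
    IsOpen {f : HplusAC | ∀ x, (f, x) ∉ S} := by
  have h := (isClosedMap_fst_of_compactSpace S hS).isOpen_compl
  convert h using 1
  ext f
  simp

theorem isOpen_setOf_apply_lt (x : unitInterval) : IsOpen {f : HplusAC | f.1 x < x} :=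
  isOpen_lt (continuous_apply.comp (Continuous.prodMk_left x)) continuous_const

theorem isOpen_setOf_lt_apply (x : unitInterval) : IsOpen {f : HplusAC | x < f.1 x} :=
  isOpen_lt continuous_const (continuous_apply.comp (Continuous.prodMk_left x))

/-- By outer regularity `Fix f` lies in an open `U` of measure less than `r`. Having no fixed point
in the compact set `Uᶜ` is an open condition. -/
theorem isOpen_setOf_volume_Fix_lt (r : ENNReal) : IsOpen {f : HplusAC | volume f.1.Fix < r} := by
  rw [isOpen_iff_mem_nhds]
  intro f hf
  obtain ⟨U, hFU, hU, hUr⟩ := Set.exists_isOpen_lt_of_lt f.1.Fix r hf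
  have ho := isOpen_forall_of_isClosed (S := {p | p.1.1 p.2 = p.2 ∧ p.2 ∈ Uᶜ})
    ((isClosed_eq continuous_apply continuous_snd).inter
      (hU.isClosed_compl.preimage continuous_snd))
  refine mem_of_superset (ho.mem_nhds fun x hx => hx.2 (hFU hx.1)) fun g hg => ?_
  refine lt_of_le_of_lt (measure_mono fun x hx => ?_) hUr
  by_contra hxU
  exact hg x ⟨hx, hxU⟩

theorem isGδ_setOf_volume_Fix_eq_zero : IsGδ {f : HplusAC | volume f.1.Fix = 0} := by
  have h : {f : HplusAC | volume f.1.Fix = 0} =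
      ⋂ n : ℕ, {f : HplusAC | volume f.1.Fix < ((n : ENNReal) + 1)⁻¹} := by
    ext f
    simp only [mem_ofPred_eq, mem_iInter]
    constructor
    · intro h n
      rw [h]
      simp
    · intro h
      by_contra h0
      obtain ⟨n, hn⟩ := ENNReal.exists_inv_nat_lt h0
      exact lt_asymm (h n) (lt_of_le_of_lt (ENNReal.inv_le_inv.2 le_self_add) hn)
  rw [h]
  exact .iInter fun n => (isOpen_setOf_volume_Fix_lt _).isGδ

/-- The elements `f` for which `f - id` takes positive, negative and positive values, in this
order, on `B`. -/
def alternatingOn (B : Set unitInterval) : Set HplusAC :=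
  {f | ∃ x₁ ∈ B, ∃ x₂ ∈ B, ∃ x₃ ∈ B,
    x₁ < x₂ ∧ x₂ < x₃ ∧ x₁ < f.1 x₁ ∧ f.1 x₂ < x₂ ∧ x₃ < f.1 x₃}

theorem isOpen_alternatingOn (B : Set unitInterval) : IsOpen (alternatingOn B) := by
  rw [isOpen_iff_mem_nhds]
  rintro f ⟨x₁, h1, x₂, h2, x₃, h3, h12, h23, p1, p2, p3⟩
  filter_upwards [(isOpen_setOf_lt_apply x₁).mem_nhds p1, (isOpen_setOf_apply_lt x₂).mem_nhds p2,
    (isOpen_setOf_lt_apply x₃).mem_nhds p3] with g q1 q2 q3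
  exact ⟨x₁, h1, x₂, h2, x₃, h3, h12, h23, q1, q2, q3⟩

/-- For each scale `1/(n+1)`, the pairs `(f, z)` with `z` fixed and no alternating triple within
that distance of `z` form a closed set, so avoiding it for all `z` is open. -/
theorem isGδ_setOf_isAlternating : IsGδ {f : HplusAC | f.1.IsAlternating} := by
  have h : {f : HplusAC | f.1.IsAlternating} =
      ⋂ n : ℕ, {f : HplusAC | ∀ z, (f, z) ∉ {p : HplusAC × unitInterval | p.1.1 p.2 = p.2 ∧
        p ∉ ⋃ x₁, ⋃ x₂, ⋃ x₃, {p : HplusAC × unitInterval |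
          (dist x₁ p.2 < 1 / ((n : ℝ) + 1) ∧ dist x₂ p.2 < 1 / ((n : ℝ) + 1) ∧
            dist x₃ p.2 < 1 / ((n : ℝ) + 1)) ∧ x₁ < x₂ ∧ x₂ < x₃ ∧
          x₁ < p.1.1 x₁ ∧ p.1.1 x₂ < x₂ ∧ x₃ < p.1.1 x₃}}} := by
    ext f
    simp only [mem_ofPred_eq, mem_iInter, mem_iUnion, not_and, not_not]
    constructor
    · intro h n z hz
      obtain ⟨x₁, h1, x₂, h2, x₃, h3, h'⟩ := h z hz (Metric.ball z (1 / ((n : ℝ) + 1)))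
        (Metric.ball_mem_nhds _ (by positivity))
      exact ⟨x₁, x₂, x₃, ⟨h1, h2, h3⟩, h'⟩
    · intro h z hz U hU
      obtain ⟨ε, hε, hsub⟩ := Metric.mem_nhds_iff.1 hU
      obtain ⟨n, hn⟩ := exists_nat_one_div_lt hε
      obtain ⟨x₁, x₂, x₃, ⟨h1, h2, h3⟩, h'⟩ := h n z hz
      exact ⟨x₁, hsub (h1.trans hn), x₂, hsub (h2.trans hn), x₃, hsub (h3.trans hn), h'⟩
  rw [h]
  refine .iInter fun n => (isOpen_forall_of_isClosed ?_).isGδ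
  refine (isClosed_eq continuous_apply continuous_snd).inter (IsOpen.isClosed_compl ?_)
  refine isOpen_iUnion fun x₁ => isOpen_iUnion fun x₂ => isOpen_iUnion fun x₃ => ?_
  have hd : ∀ x : unitInterval,
      IsOpen {p : HplusAC × unitInterval | dist x p.2 < 1 / ((n : ℝ) + 1)} := fun x =>
    isOpen_lt (continuous_const.dist continuous_snd) continuous_const
  refine ((hd x₁).inter ((hd x₂).inter (hd x₃))).inter
    ((isOpen_const (p := x₁ < x₂)).inter ((isOpen_const (p := x₂ < x₃)).inter ?_))
  exact ((isOpen_setOf_lt_apply x₁).preimage continuous_fst).inter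
    (((isOpen_setOf_apply_lt x₂).preimage continuous_fst).inter
      ((isOpen_setOf_lt_apply x₃).preimage continuous_fst))

theorem setCN_eq :
    setCN = {f : HplusAC | f.1.IsAlternating} ∩ {f : HplusAC | volume f.1.Fix = 0} := by
  ext f
  exact Hplus.mem_setC_inter_setN_iff

theorem isGδ_setCN : IsGδ setCN := by
  rw [setCN_eq]
  exact isGδ_setOf_isAlternating.inter isGδ_setOf_volume_Fix_eq_zero

/-! ### `setCN` is dense -/

theorem exists_convexCombination (f k : HplusAC) {t : ℝ} (h0 : 0 < t) (h1 : t < 1) :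
    ∃ g : HplusAC, (∀ x, (g.1 x : ℝ) = (1 - t) * f.1 x + t * k.1 x) ∧ dist f g = t * dist f k := by
  have hf := f.2.1.integrable_density
  have hk := k.2.1.integrable_density
  obtain ⟨g, hg, hd⟩ := Hplus.exists_of_density
    (r := fun x => (1 - t) * f.1.density x + t * k.1.density x)
    ((hf.const_mul _).add (hk.const_mul _)) (by
      filter_upwards [Hplus.density_pos_ae f.2, Hplus.density_pos_ae k.2] with x hx hx'
      have : 0 < 1 - t := by linarith
      positivity) (by
      rw [integral_add (hf.const_mul _) (hk.const_mul _), integral_const_mul, integral_const_mul,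
        f.2.1.integral_density, k.2.1.integral_density]
      ring)
  refine ⟨g, fun x => ?_, ?_⟩
  · rw [hg, integral_add (hf.const_mul _).integrableOn (hk.const_mul _).integrableOn,
      integral_const_mul, integral_const_mul, ← f.2.1.eq_setIntegral, ← k.2.1.eq_setIntegral]
  · rw [dist_eq, dist_eq, ← integral_const_mul]
    refine integral_congr_ae ?_
    filter_upwards [hd] with x hx
    rw [hx, ← abs_of_pos h0, ← abs_mul, abs_of_pos h0]
    congr 1
    ring

theorem exists_polynomial_perturbation (φ : Polynomial ℝ) (h0 : φ.eval 0 = 0)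
    (h1 : φ.eval 1 = 0) :
    ∃ c : ℝ, 0 < c ∧ ∃ k : HplusAC, ∀ x, (k.1 x : ℝ) = x + c * φ.eval (x : ℝ) := by
  obtain ⟨M, hM⟩ := (isCompact_Icc (a := (0 : ℝ)) (b := 1)).exists_bound_of_continuousOn
    φ.derivative.continuousOn
  have hM0 : 0 ≤ M := (norm_nonneg _).trans (hM 0 ⟨le_rfl, zero_le_one⟩)
  -- With `M` a bound for `|φ'|` on `[0,1]`, this makes `c M < 1`, so the density `1 + c φ'` is
  -- positive; `M + 1` avoids dividing by zero.
  set c : ℝ := 1 / (2 * (M + 1)) with hc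
  have hc0 : 0 < c := by positivity
  have hcM : c * M < 1 := by
    rw [hc, div_mul_eq_mul_div, div_lt_one (by positivity)]
    linarith
  set g : ℝ → ℝ := fun y => 1 + c * φ.derivative.eval y with hg
  have hgc : Continuous g := by fun_prop
  have hint : ∀ y : ℝ, ∫ v in (0 : ℝ)..y, g v = y + c * φ.eval y := by
    intro y
    rw [intervalIntegral.integral_eq_sub_of_hasDerivAt (f := fun v => v + c * φ.eval v)
      (fun v _ => (hasDerivAt_id v).add ((φ.hasDerivAt v).const_mul c))
      (hgc.intervalIntegrable _ _), h0]
    ring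
  obtain ⟨k, hk, -⟩ := Hplus.exists_of_density (r := fun x => g x)
    (integrable_coe_iff_intervalIntegrable.2 (hgc.intervalIntegrable _ _))
    (ae_of_all _ fun x => by
      have h2 := hM x x.2
      rw [Real.norm_eq_abs, abs_le] at h2
      have h3 : c * -M ≤ c * φ.derivative.eval (x : ℝ) := mul_le_mul_of_nonneg_left h2.1 hc0.le
      simp only [hg]
      linarith)
    (by rw [integral_coe, hint, h1]; ring)
  exact ⟨c, hc0, k, fun x => by rw [hk, setIntegral_Iic_coe, hint]⟩

theorem exists_lt_apply : ∃ k : HplusAC, ∀ x : unitInterval, 0 < x → x < 1 → x < k.1 x := by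
  obtain ⟨c, hc, k, hk⟩ := exists_polynomial_perturbation
    (Polynomial.X * (1 - Polynomial.X)) (by simp) (by simp)
  refine ⟨k, fun x hx0 hx1 => ?_⟩
  have h0 : (0 : ℝ) < x := hx0
  have h1 : (0 : ℝ) < 1 - x := sub_pos.2 hx1
  have h2 := hk x
  simp only [Polynomial.eval_mul, Polynomial.eval_X, Polynomial.eval_sub, Polynomial.eval_one] at h2
  have h3 : 0 < c * (x * (1 - x)) := by positivity
  exact Subtype.coe_lt_coe.1 (by linarith)

theorem exists_mem_alternatingOn {p q : unitInterval} (hpq : p < q) :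
    (alternatingOn (Ioo p q)).Nonempty := by
  obtain ⟨m₁, hpm, hmq⟩ := exists_between hpq
  obtain ⟨m₂, hmm, hm₂q⟩ := exists_between hmq
  obtain ⟨x₁, h1, h1'⟩ := exists_between hpm
  obtain ⟨x₂, h2, h2'⟩ := exists_between hmm
  obtain ⟨x₃, h3, h3'⟩ := exists_between hm₂q
  -- The polynomial `x (1 - x) (x - m₁) (x - m₂)` is positive, negative and positive at `x₁ < m₁ <
  -- x₂ < m₂ < x₃`.
  obtain ⟨c, hc, k, hk⟩ := exists_polynomial_perturbation
    (Polynomial.X * (1 - Polynomial.X) * (Polynomial.X - Polynomial.C (m₁ : ℝ)) *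
      (Polynomial.X - Polynomial.C (m₂ : ℝ))) (by simp) (by simp)
  simp only [Polynomial.eval_mul, Polynomial.eval_X, Polynomial.eval_sub, Polynomial.eval_one,
    Polynomial.eval_C] at hk
  have hpos : ∀ x : unitInterval, p < x → x < q → 0 < (x : ℝ) * (1 - x) := fun x hx hx' =>
    mul_pos (lt_of_le_of_lt p.2.1 hx) (sub_pos.2 (lt_of_lt_of_le hx' q.2.2))
  have H1 : (x₁ : ℝ) < m₁ := h1'
  have H2 : (m₁ : ℝ) < x₂ := h2
  have H3 : (x₂ : ℝ) < m₂ := h2'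
  have H4 : (m₂ : ℝ) < x₃ := h3
  have P1 := hpos x₁ h1 (h1'.trans hmq)
  have P2 := hpos x₂ (hpm.trans h2) (h2'.trans hm₂q)
  have P3 := hpos x₃ ((hpm.trans hmm).trans h3) h3'
  refine ⟨k, x₁, ⟨h1, h1'.trans hmq⟩, x₂, ⟨hpm.trans h2, h2'.trans hm₂q⟩, x₃,
    ⟨(hpm.trans hmm).trans h3, h3'⟩, h1'.trans h2, h2'.trans h3, ?_, ?_, ?_⟩
  · have h : 0 < c * (x₁ * (1 - x₁) * (x₁ - m₁) * (x₁ - m₂) : ℝ) :=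
      mul_pos hc (mul_pos_of_neg_of_neg (mul_neg_of_pos_of_neg P1 (by linarith)) (by linarith))
    exact Subtype.coe_lt_coe.1 (by rw [hk]; linarith)
  · have h : c * (x₂ * (1 - x₂) * (x₂ - m₁) * (x₂ - m₂) : ℝ) < 0 :=
      mul_neg_of_pos_of_neg hc (mul_neg_of_pos_of_neg (mul_pos P2 (by linarith)) (by linarith))
    exact Subtype.coe_lt_coe.1 (by rw [hk]; linarith)
  · have h : 0 < c * (x₃ * (1 - x₃) * (x₃ - m₁) * (x₃ - m₂) : ℝ) :=
      mul_pos hc (mul_pos (mul_pos P3 (by linarith)) (by linarith))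
    exact Subtype.coe_lt_coe.1 (by rw [hk]; linarith)

/-- Take `k` above the identity on `(0,1)`. A point `x` there is fixed by `(1 - t) f + t k` for at
most one `t`, so the fixed sets for different `t` are disjoint in `(0,1)`. Only countably many have
positive measure, which leaves arbitrarily small good `t`. -/
theorem dense_setOf_volume_Fix_eq_zero : Dense {f : HplusAC | volume f.1.Fix = 0} := by
  rw [Metric.dense_iff]
  intro f ε hε
  obtain ⟨k, hk⟩ := exists_lt_apply
  choose g hg hgd using fun t : Ioo (0 : ℝ) 1 => exists_convexCombination f k t.2.1 t.2.2
  have hdisj : Pairwise (Function.onFun Disjoint fun t => (g t).1.Fix ∩ Ioo 0 1) := by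
    intro s t hst
    rw [Function.onFun, Set.disjoint_left]
    rintro x ⟨hs, hx⟩ ⟨ht, -⟩
    have h1 : (x : ℝ) = (1 - s) * f.1 x + s * k.1 x := by
      rw [← hg s x]; exact congrArg _ (Eq.symm hs)
    have h2 : (x : ℝ) = (1 - t) * f.1 x + t * k.1 x := by
      rw [← hg t x]; exact congrArg _ (Eq.symm ht)
    have h3 : (x : ℝ) < k.1 x := hk x hx.1 hx.2
    have h4 : ((s : ℝ) - t) * (k.1 x - f.1 x) = 0 := by linarith
    rcases mul_eq_zero.1 h4 with h | h
    · exact hst (Subtype.ext (sub_eq_zero.1 h))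
    -- If `k x = f x`, the combination takes the value `k x > x` at `x`, so `x` is not fixed.
    · rw [← sub_eq_zero.1 h] at h1
      linarith
  have hcount := Measure.countable_meas_pos_of_disjoint_iUnion (μ := volume)
    (fun t => ((g t).1.isClosed_Fix.measurableSet.inter measurableSet_Ioo)) hdisj
  have hdense := (hcount.image Subtype.val).dense_compl ℝ
  set δ : ℝ := min 1 (ε / (dist f k + 1)) with hδ
  have hδ0 : 0 < δ := lt_min one_pos (by positivity)
  obtain ⟨t, ht, htc⟩ := hdense.exists_mem_open (isOpen_Ioo (a := 0) (b := δ)) ⟨δ / 2, by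
    constructor <;> linarith⟩
  have htI : t ∈ Ioo (0 : ℝ) 1 := ⟨htc.1, htc.2.trans_le (min_le_left _ _)⟩
  refine ⟨g ⟨t, htI⟩, ?_, ?_⟩
  · rw [Metric.mem_ball, dist_comm, hgd]
    have h1 : t * (dist f k + 1) < ε :=
      (lt_div_iff₀ (by positivity)).1 (htc.2.trans_le (min_le_right _ _))
    have h2 : 0 < t := htc.1
    simp only
    linarith
  · have h1 : volume ((g ⟨t, htI⟩).1.Fix ∩ Ioo 0 1) = 0 := by
      by_contra h
      exact ht ⟨⟨t, htI⟩, pos_iff_ne_zero.2 h, rfl⟩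
    have h2 : volume ({0, 1} : Set unitInterval) = 0 := (Set.toFinite _).measure_zero _
    refine measure_mono_null (t := ((g ⟨t, htI⟩).1.Fix ∩ Ioo 0 1) ∪ {0, 1}) (fun x hx => ?_)
      (measure_union_null h1 h2)
    rcases eq_or_ne x 0 with rfl | h0
    · exact Or.inr (Or.inl rfl)
    rcases eq_or_ne x 1 with rfl | h1
    · exact Or.inr (Or.inr rfl)
    exact Or.inl ⟨hx, unitInterval.pos_iff_ne_zero.2 h0, unitInterval.lt_one_iff_ne_one.2 h1⟩

end HplusAC

theorem setIntegral_Iic_add_Ioc {r : unitInterval → ℝ} (hr : Integrable r) {x y : unitInterval}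
    (hxy : x ≤ y) : ∫ z in Iic y, r z = (∫ z in Iic x, r z) + ∫ z in Ioc x y, r z := by
  rw [← Iic_union_Ioc_eq_Iic hxy, setIntegral_union (Iic_disjoint_Ioc le_rfl) measurableSet_Ioc
    hr.integrableOn hr.integrableOn]

theorem setIntegral_Ioc_of_eq_const {r : unitInterval → ℝ} {c : ℝ} {x y : unitInterval}
    (hxy : x ≤ y) (h : ∀ z ∈ Ioc x y, r z = c) : ∫ z in Ioc x y, r z = c * (y - x) := by
  rw [setIntegral_congr_fun measurableSet_Ioc h, setIntegral_const, Measure.real,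
    unitInterval.volume_Ioc, ENNReal.toReal_ofReal (sub_nonneg.2 hxy), smul_eq_mul, mul_comm]

namespace HplusAC

/-- On `(a, b]` the graph of `f` is replaced by the segments through `(a, f a)`, `(p, p)`, `(q, q)`,
`(b, f b)`. The cost is at most the sum of the two increments over `(a, b]`, both equal to `f b - f
a`. The degenerate cases `a = p` and `q = b` serve intervals with a fixed point of `f` as an
endpoint. -/
theorem exists_eq_id_on (f : HplusAC) {a p q b : unitInterval} (hap : a ≤ p) (hpq : p < q)
    (hqb : q ≤ b) (h1 : a < p → f.1 a < p) (h2 : a = p → f.1 a = p) (h3 : q < b → q < f.1 b)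
    (h4 : q = b → f.1 b = q) :
    ∃ g : HplusAC, (∀ x ∈ Icc p q, g.1 x = x) ∧ dist f g ≤ 2 * (f.1 b - f.1 a) := by
  classical
  have hf := f.2.1.integrable_density
  -- Slopes of the outer segments; when a segment degenerates, the slope is the default value 0 and
  -- is used on an empty interval.
  set s₁ : ℝ := (p - f.1 a) / (p - a) with hs₁
  set s₂ : ℝ := (f.1 b - q) / (b - q) with hs₂
  have e₁ : s₁ * (p - a) = p - f.1 a := by
    rcases hap.eq_or_lt with h | h
    · rw [h2 h, h]; simp
    · exact div_mul_cancel₀ _ (sub_pos.2 (Subtype.coe_lt_coe.2 h)).ne'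
  have e₂ : s₂ * (b - q) = f.1 b - q := by
    rcases hqb.eq_or_lt with h | h
    · rw [h4 h, h]; simp
    · exact div_mul_cancel₀ _ (sub_pos.2 (Subtype.coe_lt_coe.2 h)).ne'
  set r : unitInterval → ℝ := fun x => if x ∈ Ioc a p then s₁ else if x ∈ Ioc p q then 1 else
    if x ∈ Ioc q b then s₂ else f.1.density x with hrdef
  have hr : Integrable r := by
    have hi : ∀ (c : ℝ) (s : Set unitInterval) [DecidablePred (· ∈ s)], MeasurableSet s →
        ∀ u : unitInterval → ℝ,
        Integrable u → Integrable fun x => if x ∈ s then c else u x := by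
      intro c s _ hs u hu
      exact Integrable.piecewise hs (integrable_const c).integrableOn hu.integrableOn
    exact hi _ _ measurableSet_Ioc _ (hi _ _ measurableSet_Ioc _ (hi _ _ measurableSet_Ioc _ hf))
  have ha : ∀ x ∉ Ioc a b, r x = f.1.density x := by
    intro x hx
    simp only [hrdef]
    rw [if_neg fun h => hx ⟨h.1, h.2.trans (hpq.le.trans hqb)⟩,
      if_neg fun h => hx ⟨hap.trans_lt h.1, h.2.trans hqb⟩,
      if_neg fun h => hx ⟨(hap.trans hpq.le).trans_lt h.1, h.2⟩]
  have r₁ : ∀ x ∈ Ioc a p, r x = s₁ := fun x hx => if_pos hx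
  have r₂ : ∀ x ∈ Ioc p q, r x = 1 := fun x hx => by
    simp only [hrdef]
    rw [if_neg fun h => not_le.2 hx.1 h.2, if_pos hx]
  have r₃ : ∀ x ∈ Ioc q b, r x = s₂ := fun x hx => by
    simp only [hrdef]
    rw [if_neg fun h => not_le.2 (hpq.trans hx.1) h.2, if_neg fun h => not_le.2 hx.1 h.2, if_pos hx]
  have hpos : ∀ᵐ x, 0 < r x := by
    filter_upwards [Hplus.density_pos_ae f.2] with x hx
    by_cases c₁ : x ∈ Ioc a p
    · rw [r₁ x c₁]
      have h : a < p := c₁.1.trans_le c₁.2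
      exact div_pos (sub_pos.2 (h1 h)) (sub_pos.2 h)
    by_cases c₂ : x ∈ Ioc p q
    · rw [r₂ x c₂]; exact one_pos
    by_cases c₃ : x ∈ Ioc q b
    · rw [r₃ x c₃]
      have h : q < b := c₃.1.trans_le c₃.2
      exact div_pos (sub_pos.2 (h3 h)) (sub_pos.2 h)
    · simp only [hrdef]
      rwa [if_neg c₁, if_neg c₂, if_neg c₃]
  have Fa : ∫ z in Iic a, r z = f.1 a := by
    rw [f.2.1.eq_setIntegral]
    exact setIntegral_congr_fun measurableSet_Iic fun x hx => ha x fun h => not_le.2 h.1 hx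
  have Fp : ∫ z in Iic p, r z = p := by
    rw [setIntegral_Iic_add_Ioc hr hap, Fa, setIntegral_Ioc_of_eq_const hap r₁, e₁]
    ring
  have Fx : ∀ x ∈ Icc p q, ∫ z in Iic x, r z = x := by
    intro x hx
    rw [setIntegral_Iic_add_Ioc hr hx.1, Fp,
      setIntegral_Ioc_of_eq_const hx.1 fun z hz => r₂ z ⟨hz.1, hz.2.trans hx.2⟩]
    ring
  have Fb : ∫ z in Iic b, r z = f.1 b := by
    rw [setIntegral_Iic_add_Ioc hr hqb, Fx q ⟨hpq.le, le_rfl⟩,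
      setIntegral_Ioc_of_eq_const hqb r₃, e₂]
    ring
  have hab : a ≤ b := hap.trans (hpq.le.trans hqb)
  have F1 : ∫ z, r z = 1 := by
    have k1 := setIntegral_Iic_add_Ioc hr (x := b) (y := 1) b.2.2
    have k2 := setIntegral_Iic_add_Ioc hf (x := b) (y := 1) b.2.2
    rw [← f.2.1.eq_setIntegral, ← f.2.1.eq_setIntegral, f.1.map_one'] at k2
    rw [Fb, setIntegral_congr_fun measurableSet_Ioc
      (fun x hx => ha x fun h => not_le.2 hx.1 h.2 : EqOn r f.1.density (Ioc b 1)), ← k2,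
      show (Iic (1 : unitInterval)) = univ from Iic_top, setIntegral_univ] at k1
    exact k1
  obtain ⟨g, hg, hgd⟩ := Hplus.exists_of_density hr hpos F1
  refine ⟨g, fun x hx => Subtype.ext (by rw [hg, Fx x hx]), ?_⟩
  have k1 := setIntegral_Iic_add_Ioc hr hab
  have k2 := setIntegral_Iic_add_Ioc hf hab
  rw [← f.2.1.eq_setIntegral, ← f.2.1.eq_setIntegral] at k2
  rw [Fa, Fb] at k1
  rw [dist_eq]
  calc ∫ x, |f.1.density x - g.1.density x|
      = ∫ x, |f.1.density x - r x| := by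
        refine integral_congr_ae ?_
        filter_upwards [hgd] with x hx
        rw [hx]
    _ = ∫ x in Ioc a b, |f.1.density x - r x| := by
        refine (setIntegral_eq_integral_of_forall_compl_eq_zero fun x hx => ?_).symm
        rw [ha x hx, sub_self, abs_zero]
    _ ≤ ∫ x in Ioc a b, (f.1.density x + r x) := by
        refine setIntegral_mono_ae (hf.sub hr).abs.integrableOn (hf.add hr).integrableOn ?_
        filter_upwards [hpos] with x hx
        have := f.1.density_nonneg x
        rw [abs_le]
        constructor <;> linarith
    _ = 2 * (f.1 b - f.1 a) := by
        rw [integral_add hf.integrableOn hr.integrableOn]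
        linarith

/-- Where `f` is the identity, mixing in a small proportion `t` of an alternating `k` gives `g - id
= t (k - id)`, which has the signs of `k - id`. -/
theorem mem_closure_alternatingOn_of_eq_id {B : Set unitInterval} {f : HplusAC}
    {p q : unitInterval} (hpq : p < q) (hsub : Ioo p q ⊆ B) (hf : ∀ x ∈ Icc p q, f.1 x = x) :
    f ∈ closure (alternatingOn B) := by
  rw [Metric.mem_closure_iff]
  intro ε hε
  obtain ⟨k, x₁, h1, x₂, h2, x₃, h3, h12, h23, p1, p2, p3⟩ := exists_mem_alternatingOn hpq
  set t : ℝ := min (1 / 2) (ε / (dist f k + 1)) with ht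
  have ht0 : 0 < t := lt_min (by norm_num) (by positivity)
  have ht1 : t < 1 := (min_le_left _ _).trans_lt (by norm_num)
  have htε : t * (dist f k + 1) ≤ ε := (le_div_iff₀ (by positivity)).1 (min_le_right _ _)
  obtain ⟨g, hg, hgd⟩ := exists_convexCombination f k ht0 ht1
  have key : ∀ x ∈ Ioo p q, (g.1 x : ℝ) = x + t * (k.1 x - x) := by
    intro x hx
    rw [hg, hf x ⟨hx.1.le, hx.2.le⟩]
    ring
  refine ⟨g, ⟨x₁, hsub h1, x₂, hsub h2, x₃, hsub h3, h12, h23, ?_, ?_, ?_⟩, ?_⟩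
  · have : 0 < t * ((k.1 x₁ : ℝ) - x₁) := mul_pos ht0 (sub_pos.2 p1)
    exact Subtype.coe_lt_coe.1 (by rw [key x₁ h1]; linarith)
  · have : t * ((k.1 x₂ : ℝ) - x₂) < 0 := mul_neg_of_pos_of_neg ht0 (sub_neg.2 p2)
    exact Subtype.coe_lt_coe.1 (by rw [key x₂ h2]; linarith)
  · have : 0 < t * ((k.1 x₃ : ℝ) - x₃) := mul_pos ht0 (sub_pos.2 p3)
    exact Subtype.coe_lt_coe.1 (by rw [key x₃ h3]; linarith)
  · rw [hgd]
    linarith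

theorem mem_closure_alternatingOn {B : Set unitInterval} (hB : IsOpen B) {f : HplusAC}
    {z : unitInterval} (hz : f.1 z = z) (hzB : z ∈ B) : f ∈ closure (alternatingOn B) := by
  -- The approximations to `f` built below are the identity on a small interval, hence lie only in
  -- the closure.
  rw [← closure_closure, Metric.mem_closure_iff]
  intro ε hε
  have hsmall : ∀ᶠ x in 𝓝 z, |(f.1 x : ℝ) - z| < ε / 2 := by
    have hc : Continuous fun x => |(f.1 x : ℝ) - z| :=
      ((continuous_subtype_val.comp f.1.continuous).sub continuous_const).abs
    have h0 : |(f.1 z : ℝ) - z| < ε / 2 := by rw [hz, sub_self, abs_zero]; positivity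
    exact hc.continuousAt.eventually (gt_mem_nhds h0)
  have hU := inter_mem hsmall (hB.mem_nhds hzB)
  rcases eq_or_ne z 0 with rfl | hz0
  · obtain ⟨u, hu, hsub⟩ := exists_Ico_subset_of_mem_nhds hU ⟨1, zero_lt_one⟩
    obtain ⟨b, hb0, hbu⟩ := exists_between hu
    have hfb : 0 < f.1 b := by
      rw [← hz]; exact f.1.strictMono hb0
    -- Taking `q` below both `b` and `f b` keeps the connecting segment increasing; `a = p = 0` is
    -- the degenerate end.
    obtain ⟨q, hq0, hq⟩ := exists_between (lt_min hb0 hfb)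
    have hqb := hq.trans_le (min_le_left _ _)
    obtain ⟨g, hg, hgd⟩ := exists_eq_id_on f le_rfl hq0 hqb.le (fun h => absurd h (lt_irrefl _))
      (fun _ => hz) (fun _ => hq.trans_le (min_le_right _ _)) (fun h => absurd h hqb.ne)
    refine ⟨g, mem_closure_alternatingOn_of_eq_id hq0 (fun x hx =>
      (hsub ⟨hx.1.le, (hx.2.trans hqb).trans hbu⟩).2) hg, hgd.trans_lt ?_⟩
    have h := (hsub ⟨hb0.le, hbu⟩).1
    simp only [mem_ofPred_eq] at h
    rw [hz]
    linarith [(abs_lt.1 h).2]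
  · obtain ⟨u, hu, hsub⟩ := exists_Ioc_subset_of_mem_nhds hU
      ⟨0, unitInterval.pos_iff_ne_zero.2 hz0⟩
    obtain ⟨a, hua, haz⟩ := exists_between hu
    have hfa : f.1 a < z := by
      conv_rhs => rw [← hz]
      exact f.1.strictMono haz
    -- Mirror image: the identity is inserted on `[p, z]`, to the left of the fixed point `z = q =
    -- b`.
    obtain ⟨p, hp, hpz⟩ := exists_between (max_lt haz hfa)
    have hap := (le_max_left _ _).trans_lt hp
    obtain ⟨g, hg, hgd⟩ := exists_eq_id_on f hap.le hpz le_rfl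
      (fun _ => (le_max_right _ _).trans_lt hp) (fun h => absurd h hap.ne)
      (fun h => absurd h (lt_irrefl _)) (fun _ => hz)
    refine ⟨g, mem_closure_alternatingOn_of_eq_id hpz (fun x hx =>
      (hsub ⟨(hua.trans hap).trans hx.1, hx.2.le⟩).2) hg, hgd.trans_lt ?_⟩
    have h := (hsub ⟨hua, haz.le⟩).1
    simp only [mem_ofPred_eq] at h
    rw [hz]
    linarith [(abs_lt.1 h).1]

/-- For each basic open `B`, the union of `alternatingOn B` and the complement of its closure is
open and dense. An `f` in all of these with a fixed point in `B` is in the closure, hence in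
`alternatingOn B`. -/
theorem dense_setOf_isAlternating : Dense {f : HplusAC | f.1.IsAlternating} := by
  have hb := TopologicalSpace.isBasis_countableBasis unitInterval
  have hd : Dense (⋂ B ∈ TopologicalSpace.countableBasis unitInterval,
      (alternatingOn B ∪ (closure (alternatingOn B))ᶜ)) := by
    refine dense_biInter_of_isOpen
      (fun B _ => (isOpen_alternatingOn B).union isClosed_closure.isOpen_compl)
      (TopologicalSpace.countable_countableBasis _) fun B _ f => ?_
    by_cases h : f ∈ closure (alternatingOn B)
    · exact closure_mono subset_union_left h
    · exact subset_closure (Or.inr h)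
  refine hd.mono fun f hf z hz U hU => ?_
  obtain ⟨B, hB, hzB, hBU⟩ := hb.mem_nhds_iff.1 hU
  rcases mem_iInter₂.1 hf B hB with h | h
  · obtain ⟨x₁, h1, x₂, h2, x₃, h3, h'⟩ := h
    exact ⟨x₁, hBU h1, x₂, hBU h2, x₃, hBU h3, h'⟩
  · exact absurd (mem_closure_alternatingOn (hb.isOpen hB) hz hzB) h

theorem dense_setCN : Dense setCN := by
  rw [setCN_eq]
  exact dense_setOf_isAlternating.inter_of_Gδ isGδ_setOf_isAlternating
    isGδ_setOf_volume_Fix_eq_zero dense_setOf_volume_Fix_eq_zero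

end HplusAC

/-! ### Back-and-forth for coloured dense orders -/

section ColoredBackAndForth

variable {α β C : Type*} [LinearOrder α] [LinearOrder β]

/-- Either finite set may be empty, so two points `m < n` are first placed in the gap, and density
of the colour is used between them. -/
theorem exists_colored_between_finsets [DenselyOrdered α] [NoMinOrder α] [NoMaxOrder α]
    [Nonempty α] {a : α → C} (ha : ∀ x y, x < y → ∀ c, ∃ z, x < z ∧ z < y ∧ a z = c) (c : C)
    (lo hi : Finset α) (h : ∀ x ∈ lo, ∀ y ∈ hi, x < y) :
    ∃ m, a m = c ∧ (∀ x ∈ lo, x < m) ∧ ∀ y ∈ hi, m < y := by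
  classical
  obtain ⟨m, hm1, hm2⟩ := Order.exists_between_finsets lo hi h
  obtain ⟨n, hn1, hn2⟩ := Order.exists_between_finsets (insert m lo) hi (by
    intro x hx y hy
    rcases Finset.mem_insert.1 hx with rfl | hx
    · exact hm2 y hy
    · exact h x hx y hy)
  obtain ⟨z, hmz, hzn, hz⟩ := ha m n (hn1 m (Finset.mem_insert_self _ _)) c
  exact ⟨z, hz, fun x hx => (hm1 x hx).trans hmz, fun y hy => hzn.trans (hn2 y hy)⟩

/-- Finite partial order isomorphisms that preserve given colourings. -/
abbrev ColoredPartialIso (a : α → C) (b : β → C) : Type _ :=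
  {f : Order.PartialIso α β // ∀ p ∈ f.val, a p.1 = b p.2}

namespace ColoredPartialIso

variable {a : α → C} {b : β → C}

theorem exists_across [DenselyOrdered β] [NoMinOrder β] [NoMaxOrder β] [Nonempty β]
    (hb : ∀ x y, x < y → ∀ c, ∃ z, x < z ∧ z < y ∧ b z = c) (f : ColoredPartialIso a b) (x : α) :
    ∃ y : β, a x = b y ∧ ∀ p ∈ f.1.val, cmp p.1 x = cmp p.2 y := by
  classical
  by_cases h : ∃ y, (x, y) ∈ f.1.val
  · obtain ⟨y, hy⟩ := h
    exact ⟨y, f.2 _ hy, fun p hp => f.1.prop _ hp _ hy⟩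
  obtain ⟨y, hy, h1, h2⟩ := exists_colored_between_finsets hb (a x)
    ({p ∈ f.1.val | p.1 < x}.image Prod.snd) ({p ∈ f.1.val | x < p.1}.image Prod.snd) (by
      intro u hu v hv
      rw [Finset.mem_image] at hu hv
      rcases hu with ⟨p, hp, rfl⟩
      rcases hv with ⟨q, hq, rfl⟩
      rw [Finset.mem_filter] at hp hq
      exact (lt_iff_lt_of_cmp_eq_cmp (f.1.prop _ hp.1 _ hq.1)).1 (hp.2.trans hq.2))
  refine ⟨y, hy.symm, fun p hp => ?_⟩
  have hne : p.1 ≠ x := fun he => h ⟨p.2, he ▸ hp⟩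
  rcases lt_or_gt_of_ne hne with hl | hl
  · rw [cmp_eq_lt_iff _ _ |>.2 hl, cmp_eq_lt_iff _ _ |>.2
      (h1 _ (Finset.mem_image.2 ⟨p, Finset.mem_filter.2 ⟨hp, hl⟩, rfl⟩))]
  · rw [cmp_eq_gt_iff _ _ |>.2 hl, cmp_eq_gt_iff _ _ |>.2
      (h2 _ (Finset.mem_image.2 ⟨p, Finset.mem_filter.2 ⟨hp, hl⟩, rfl⟩))]

/-- The inverse of a coloured partial isomorphism. -/
def comm (f : ColoredPartialIso a b) : ColoredPartialIso b a :=
  ⟨f.1.comm, fun p hp => by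
    classical
    have h : p ∈ f.1.val.image (Equiv.prodComm α β) := hp
    obtain ⟨q, hq, rfl⟩ := Finset.mem_image.1 h
    exact (f.2 q hq).symm⟩

theorem mem_comm {f : ColoredPartialIso a b} {p : β × α} :
    p ∈ f.comm.1.val ↔ p.swap ∈ f.1.val := by
  classical
  have h : p ∈ f.comm.1.val ↔ p ∈ f.1.val.image (Equiv.prodComm α β) := Iff.rfl
  rw [h, Finset.mem_image]
  constructor
  · rintro ⟨q, hq, rfl⟩
    exact hq
  · intro hp
    exact ⟨p.swap, hp, rfl⟩

/-- The coloured partial isomorphisms defined at `x` form a cofinal set. -/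
def definedAtLeft [DenselyOrdered β] [NoMinOrder β] [NoMaxOrder β] [Nonempty β]
    (a : α → C) (hb : ∀ x y, x < y → ∀ c, ∃ z, x < z ∧ z < y ∧ b z = c) (x : α) :
    Order.Cofinal (ColoredPartialIso a b) where
  carrier := {f | ∃ y : β, (x, y) ∈ f.1.val}
  isCofinal f := by
    classical
    obtain ⟨y, hxy, h⟩ := exists_across hb f x
    refine ⟨⟨⟨insert (x, y) f.1.val, fun p hp q hq => ?_⟩, fun p hp => ?_⟩,
      ⟨y, Finset.mem_insert_self _ _⟩, Finset.subset_insert _ _⟩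
    · rw [Finset.mem_insert] at hp hq
      rcases hp with (rfl | pf) <;> rcases hq with (rfl | qf)
      · simp only [cmp_self_eq_eq]
      · rw [cmp_eq_cmp_symm]
        exact h _ qf
      · exact h _ pf
      · exact f.1.prop _ pf _ qf
    · rcases Finset.mem_insert.1 hp with rfl | hp
      · exact hxy
      · exact f.2 p hp

/-- The coloured partial isomorphisms having `y` in their image form a cofinal set. -/
def definedAtRight [DenselyOrdered α] [NoMinOrder α] [NoMaxOrder α] [Nonempty α]
    (ha : ∀ x y, x < y → ∀ c, ∃ z, x < z ∧ z < y ∧ a z = c) (b : β → C) (y : β) :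
    Order.Cofinal (ColoredPartialIso a b) where
  carrier := {f | ∃ x : α, (x, y) ∈ f.1.val}
  isCofinal f := by
    obtain ⟨g, ⟨x, hx⟩, hg⟩ := (definedAtLeft b ha y).isCofinal f.comm
    refine ⟨g.comm, ⟨x, mem_comm.2 hx⟩, fun p hp => ?_⟩
    exact mem_comm.2 (hg (mem_comm.2 hp))

end ColoredPartialIso

/-- Cantor's isomorphism theorem for coloured linear orders. -/
theorem exists_colored_orderIso [Countable α] [DenselyOrdered α] [NoMinOrder α] [NoMaxOrder α]
    [Nonempty α] [Countable β] [DenselyOrdered β] [NoMinOrder β] [NoMaxOrder β] [Nonempty β]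
    {a : α → C} {b : β → C} (ha : ∀ x y, x < y → ∀ c, ∃ z, x < z ∧ z < y ∧ a z = c)
    (hb : ∀ x y, x < y → ∀ c, ∃ z, x < z ∧ z < y ∧ b z = c) :
    ∃ e : α ≃o β, ∀ x, b (e x) = a x := by
  cases nonempty_encodable α
  cases nonempty_encodable β
  let D : α ⊕ β → Order.Cofinal (ColoredPartialIso a b) := fun p =>
    Sum.recOn p (ColoredPartialIso.definedAtLeft a hb) (ColoredPartialIso.definedAtRight ha b)
  let I : Order.Ideal (ColoredPartialIso a b) := Order.idealOfCofinals
    ⟨default, fun p hp => absurd hp (Finset.notMem_empty p)⟩ D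
  have F : ∀ x, ∃ y, ∃ f ∈ I, (x, y) ∈ f.1.val := by
    intro x
    obtain ⟨f, ⟨y, hy⟩, hf⟩ := Order.cofinal_meets_idealOfCofinals _ D (Sum.inl x)
    exact ⟨y, f, hf, hy⟩
  have G : ∀ y, ∃ x, ∃ f ∈ I, (x, y) ∈ f.1.val := by
    intro y
    obtain ⟨f, ⟨x, hx⟩, hf⟩ := Order.cofinal_meets_idealOfCofinals _ D (Sum.inr y)
    exact ⟨x, f, hf, hx⟩
  choose u f hf hu using F
  choose v g hg hv using G
  refine ⟨OrderIso.ofCmpEqCmp u v fun x y => ?_, fun x => ((f x).2 _ (hu x)).symm⟩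
  obtain ⟨m, -, fm, gm⟩ := I.directed _ (hf x) _ (hg y)
  exact m.1.prop _ (fm (hu x)) _ (gm (hv y))

end ColoredBackAndForth

/-! ### Extending order isomorphisms from dense families -/

/-- Two families of points of `[0,1]` with dense ranges and the same order relations differ by an
order automorphism of `[0,1]`. -/
theorem exists_orderIso_of_lt_iff_lt {ι : Type*} {p q : ι → unitInterval}
    (hp : Dense (range p)) (hq : Dense (range q)) (h : ∀ i j, p i < p j ↔ q i < q j) :
    ∃ e : Hplus, ∀ i, e (p i) = q i := by
  have main : ∀ {p q : ι → unitInterval}, Dense (range p) → (∀ i j, p i < p j ↔ q i < q j) →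
      ∃ u : unitInterval → unitInterval, StrictMono u ∧ ∀ i, u (p i) = q i := by
    intro p q hp h
    refine ⟨fun x => sSup (q '' {i | p i ≤ x}), fun x y hxy => ?_, fun i => ?_⟩
    · obtain ⟨a, hxa, hay⟩ := exists_between hxy
      obtain ⟨_, ⟨i, rfl⟩, hxi, hia⟩ := hp.exists_between hxa
      obtain ⟨_, ⟨j, rfl⟩, haj, hjy⟩ := hp.exists_between hay
      calc sSup (q '' {i | p i ≤ x}) ≤ q i := by
            refine sSup_le ?_
            rintro _ ⟨k, hk, rfl⟩
            exact ((h k i).1 (lt_of_le_of_lt hk hxi)).le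
        _ < q j := (h i j).1 (hia.trans haj)
        _ ≤ sSup (q '' {i | p i ≤ y}) := le_sSup ⟨j, hjy.le, rfl⟩
    · refine le_antisymm (sSup_le ?_) (le_sSup ⟨i, le_refl (p i), rfl⟩)
      rintro _ ⟨k, hk, rfl⟩
      exact le_of_not_gt fun hlt => not_le.2 ((h i k).2 hlt) hk
  obtain ⟨u, hu, hup⟩ := main hp h
  obtain ⟨v, hv, hvq⟩ := main hq fun i j => (h i j).symm
  have hid : ∀ {p : ι → unitInterval}, Dense (range p) → ∀ w : unitInterval → unitInterval,
      StrictMono w → (∀ i, w (p i) = p i) → ∀ x, w x = x := by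
    intro p hp w hw hwp x
    rcases lt_trichotomy (w x) x with hlt | heq | hlt
    · obtain ⟨_, ⟨i, rfl⟩, h1, h2⟩ := hp.exists_between hlt
      exact absurd (hw h2) (by rw [hwp]; exact h1.le.not_gt)
    · exact heq
    · obtain ⟨_, ⟨i, rfl⟩, h1, h2⟩ := hp.exists_between hlt
      exact absurd (hw h1) (by rw [hwp]; exact h2.le.not_gt)
  -- A strictly increasing map fixing a dense set is the identity; applied to `u ∘ v`, this makes
  -- `u` surjective.
  have h1 : ∀ x, u (v x) = x :=
    hid hq _ (hu.comp hv) fun i => by simp only [hvq, hup]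
  exact ⟨hu.orderIsoOfSurjective u fun y => ⟨v y, h1 y⟩, hup⟩

/-! ### Conjugating an orbital to a translation -/

namespace Hplus

theorem zpow_apply_of_fixed {f : Hplus} {z : unitInterval} (hz : f z = z) (n : ℤ) :
    (f ^ n) z = z := by
  have h : f⁻¹ z = z := by
    conv_lhs => rw [← hz]
    exact f.symm_apply_apply z
  induction n with
  | zero => rfl
  | succ n ih => rw [zpow_add_one, RelIso.mul_apply, hz, ih]
  | pred n ih => rw [zpow_sub_one, RelIso.mul_apply, h, ih]

theorem strictMono_zpow_apply {f : Hplus} {s : unitInterval} (hs : s < f s) :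
    StrictMono fun n : ℤ => (f ^ n) s := by
  refine strictMono_int_of_lt_succ fun n => ?_
  rw [zpow_add_one, RelIso.mul_apply]
  exact (f ^ n).strictMono hs

theorem map_iSup_zpow (f : Hplus) (s : unitInterval) :
    f (⨆ n : ℤ, (f ^ n) s) = ⨆ n : ℤ, (f ^ n) s := by
  rw [f.map_iSup, ← (Equiv.addRight (1 : ℤ)).iSup_comp (g := fun n : ℤ => (f ^ n) s)]
  refine iSup_congr fun n => ?_
  change f ((f ^ n) s) = (f ^ (n + 1)) s
  rw [add_comm, zpow_one_add, RelIso.mul_apply]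

theorem map_iInf_zpow (f : Hplus) (s : unitInterval) :
    f (⨅ n : ℤ, (f ^ n) s) = ⨅ n : ℤ, (f ^ n) s := by
  rw [f.map_iInf, ← (Equiv.addRight (1 : ℤ)).iInf_comp (g := fun n : ℤ => (f ^ n) s)]
  refine iInf_congr fun n => ?_
  change f ((f ^ n) s) = (f ^ (n + 1)) s
  rw [add_comm, zpow_one_add, RelIso.mul_apply]

/-- The infimum and supremum of the `f`-orbit of `s` are fixed points, so they cannot lie in `(a,
b)`. Hence the translates of `[s, f s)` cover `(a, b)`. -/
theorem exists_zpow_le_lt {f : Hplus} {a b s x : unitInterval} (hs : s < f s)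
    (h : ∀ z ∈ Ioo a b, f z ≠ z) (hs' : s ∈ Ioo a b) (hx : x ∈ Ioo a b) :
    ∃ n : ℤ, (f ^ n) s ≤ x ∧ x < (f ^ (n + 1)) s := by
  have hmono := strictMono_zpow_apply hs
  have h1 : ∃ n : ℤ, (f ^ n) s ≤ x := by
    by_contra! hc
    refine h _ ⟨?_, ?_⟩ (f.map_iInf_zpow s)
    · exact hx.1.trans_le (le_iInf fun n => (hc n).le)
    · exact (iInf_le (fun n : ℤ => (f ^ n) s) 0).trans_lt hs'.2
  have h2 : ∃ n : ℤ, x < (f ^ n) s := by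
    by_contra! hc
    refine h _ ⟨?_, ?_⟩ (f.map_iSup_zpow s)
    · exact hs'.1.trans_le (le_iSup (fun n : ℤ => (f ^ n) s) 0)
    · exact lt_of_le_of_lt (iSup_le hc) hx.2
  obtain ⟨m, hm⟩ := h2
  obtain ⟨n, hn, hmax⟩ := Int.exists_greatest_of_bdd (P := fun n : ℤ => (f ^ n) s ≤ x)
    ⟨m, fun n hn => (hmono.lt_iff_lt.1 (lt_of_le_of_lt hn hm)).le⟩ h1
  exact ⟨n, hn, lt_of_not_ge fun hle => by have := hmax _ hle; omega⟩

/-- A parametrization of the orbital of `s` that conjugates `f` to the translation by `d`. -/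
structure IsParametrization (f : Hplus) (s : unitInterval) (d : ℝ) (θ : ℝ → unitInterval) :
    Prop where
  strictMono : StrictMono θ
  range_eq : range θ = f.orbital s
  map_apply : ∀ u, f (θ u) = θ (u + d)
  image_null : ∀ E : Set ℝ, volume E = 0 → volume (θ '' E) = 0
  preimage_null : ∀ E : Set unitInterval, volume E = 0 → volume (θ ⁻¹' E) = 0

theorem volume_image_eq_zero_of_differentiable {φ : ℝ → ℝ} (hφ : Differentiable ℝ φ) {E : Set ℝ}
    (hE : volume E = 0) : volume (φ '' E) = 0 :=
  addHaar_image_eq_zero_of_differentiableOn_of_addHaar_eq_zero _ hφ.differentiableOn hE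

/-- The fundamental domain `[s, f s]` is parametrized affinely by `A` on `[0,1]`, and the rest is
forced: `θ u = f ^ ⌊u⌋ (A (fract u))`. Null sets are preserved in both directions because `θ` is, on
each of countably many pieces, an affine map followed by a power of `f`. -/
theorem exists_isParametrization_of_lt {f : Hplus} (hf : f ∈ HplusAC) {s : unitInterval}
    (hs : s < f s) : ∃ θ, f.IsParametrization s 1 θ := by
  obtain ⟨a, b, has, hsb, ha, hb, h⟩ := f.exists_component hs.ne'
  have hmono := strictMono_zpow_apply hs
  set d : ℝ := f s - s with hd
  have hd0 : 0 < d := sub_pos.2 hs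
  set A : ℝ → unitInterval := fun t => projIcc 0 1 zero_le_one (s + t * d) with hA
  have hAc : ∀ t ∈ Icc (0 : ℝ) 1, (A t : ℝ) = s + t * d := by
    intro t ht
    have h1 : (s : ℝ) + t * d ∈ Icc (0 : ℝ) 1 := by
      have h2 : t * d ≤ 1 * d := mul_le_mul_of_nonneg_right ht.2 hd0.le
      have h3 : 0 ≤ t * d := mul_nonneg ht.1 hd0.le
      have h4 := s.2.1
      have h5 := (f s).2.2
      constructor <;> linarith
    simp only [hA]
    rw [projIcc_of_mem _ h1]
  have hA0 : A 0 = s := Subtype.ext (by rw [hAc 0 ⟨le_rfl, zero_le_one⟩]; ring)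
  have hA1 : A 1 = f s := Subtype.ext (by rw [hAc 1 ⟨zero_le_one, le_rfl⟩, hd]; ring)
  have hAm : ∀ t ∈ Icc (0 : ℝ) 1, ∀ t' ∈ Icc (0 : ℝ) 1, t < t' → A t < A t' := by
    intro t ht t' ht' htt
    have h1 : t * d < t' * d := mul_lt_mul_of_pos_right htt hd0
    exact Subtype.coe_lt_coe.1 (by rw [hAc t ht, hAc t' ht']; linarith)
  have hfr : ∀ u : ℝ, Int.fract u ∈ Icc (0 : ℝ) 1 := fun u =>
    ⟨Int.fract_nonneg u, (Int.fract_lt_one u).le⟩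
  set θ : ℝ → unitInterval := fun u => (f ^ ⌊u⌋) (A (Int.fract u)) with hθ
  have hlo : ∀ u, (f ^ ⌊u⌋) s ≤ θ u := by
    intro u
    refine (f ^ ⌊u⌋).monotone ?_
    rcases (Int.fract_nonneg u).eq_or_lt with h0 | h0
    · rw [← h0, hA0]
    · rw [← hA0]
      exact (hAm 0 ⟨le_rfl, zero_le_one⟩ _ (hfr u) h0).le
  have hhi : ∀ u, θ u < (f ^ (⌊u⌋ + 1)) s := by
    intro u
    rw [zpow_add_one, RelIso.mul_apply, ← hA1]
    exact (f ^ ⌊u⌋).strictMono (hAm _ (hfr u) 1 ⟨zero_le_one, le_rfl⟩ (Int.fract_lt_one u))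
  -- Explicit inverse of `θ` on each piece, used for preimages of null sets.
  have hpre : ∀ u : ℝ, ((((f ^ ⌊u⌋).symm (θ u) : unitInterval) : ℝ) - s) / d + ⌊u⌋ = u := by
    intro u
    simp only [hθ]
    rw [OrderIso.symm_apply_apply, hAc _ (hfr u), add_sub_cancel_left,
      mul_div_cancel_right₀ _ hd0.ne', Int.fract_add_floor]
  refine ⟨θ, ?_, ?_, ?_, ?_, ?_⟩
  · intro u v huv
    rcases (Int.floor_mono huv.le).eq_or_lt with he | hl
    · simp only [hθ]
      rw [he]
      refine (f ^ ⌊v⌋).strictMono (hAm _ (hfr u) _ (hfr v) ?_)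
      have h1 := Int.floor_add_fract u
      have h2 := Int.floor_add_fract v
      rw [he] at h1
      linarith
    · exact (hhi u).trans_le ((hmono.monotone (Int.add_one_le_iff.2 hl)).trans (hlo v))
  · rw [orbital_eq_Ioo ha hb h ⟨has, hsb⟩]
    ext x
    constructor
    · rintro ⟨u, rfl⟩
      constructor
      · refine lt_of_lt_of_le ?_ (hlo u)
        conv_lhs => rw [← zpow_apply_of_fixed ha ⌊u⌋]
        exact (f ^ ⌊u⌋).strictMono has
      · refine (hhi u).trans ?_
        conv_rhs => rw [← zpow_apply_of_fixed hb (⌊u⌋ + 1)]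
        exact (f ^ (⌊u⌋ + 1)).strictMono hsb
    · intro hx
      obtain ⟨n, h1, h2⟩ := exists_zpow_le_lt hs h ⟨has, hsb⟩ hx
      set y := (f ^ n).symm x with hy
      have hyx : (f ^ n) y = x := (f ^ n).apply_symm_apply x
      rw [← hyx, OrderIso.le_iff_le] at h1
      rw [← hyx, zpow_add_one, RelIso.mul_apply, OrderIso.lt_iff_lt] at h2
      have h1' : (s : ℝ) ≤ y := h1
      have h2' : (y : ℝ) < f s := h2
      have ht0 : 0 ≤ ((y : ℝ) - s) / d := div_nonneg (by linarith) hd0.le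
      have ht1 : ((y : ℝ) - s) / d < 1 := (div_lt_one hd0).2 (by linarith)
      have hfl : ⌊(n : ℝ) + ((y : ℝ) - s) / d⌋ = n := by
        rw [Int.floor_intCast_add, Int.floor_eq_zero_iff.2 ⟨ht0, ht1⟩, add_zero]
      refine ⟨n + ((y : ℝ) - s) / d, ?_⟩
      simp only [hθ]
      rw [hfl, Int.fract_intCast_add, Int.fract_eq_self.2 ⟨ht0, ht1⟩, ← hyx]
      congr 1
      refine Subtype.ext ?_
      rw [hAc _ ⟨ht0, ht1.le⟩, div_mul_cancel₀ _ hd0.ne']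
      ring
  · intro u
    simp only [hθ]
    rw [Int.floor_add_one, Int.fract_add_one, add_comm, zpow_one_add, RelIso.mul_apply]
  · intro E hE
    have hsub : θ '' E ⊆ ⋃ n : ℤ, (f ^ n) ''
        (Subtype.val ⁻¹' ((fun v : ℝ => (s : ℝ) + (v - n) * d) '' E)) := by
      rintro _ ⟨u, hu, rfl⟩
      refine mem_iUnion.2 ⟨⌊u⌋, A (Int.fract u), ⟨u, hu, ?_⟩, rfl⟩
      rw [hAc _ (hfr u), Int.fract]
    refine measure_mono_null hsub (measure_iUnion_null fun n => ?_)
    refine (mem_HplusAC_iff.1 (zpow_mem hf n)).1 _ ?_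
    rw [unitInterval.volume_apply]
    exact measure_mono_null (image_preimage_subset _ _)
      (volume_image_eq_zero_of_differentiable (by fun_prop) hE)
  · intro E hE
    have hsub : θ ⁻¹' E ⊆ ⋃ n : ℤ, (fun y : ℝ => (y - s) / d + n) ''
        (Subtype.val '' ((f ^ n).symm '' E)) := by
      intro u hu
      exact mem_iUnion.2 ⟨⌊u⌋, _, ⟨_, ⟨θ u, hu, rfl⟩, rfl⟩, hpre u⟩
    refine measure_mono_null hsub (measure_iUnion_null fun n => ?_)
    refine volume_image_eq_zero_of_differentiable (by fun_prop) ?_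
    rw [← unitInterval.volume_apply]
    exact (mem_HplusAC_iff.1 (zpow_mem hf n)).2 _ hE

theorem inv_apply_eq_iff {f : Hplus} {x y : unitInterval} : f⁻¹ x = y ↔ x = f y :=
  f.symm_apply_eq

theorem Fix_inv (f : Hplus) : f⁻¹.Fix = f.Fix := by
  ext x
  exact inv_apply_eq_iff.trans eq_comm

theorem orbital_inv (f : Hplus) (x : unitInterval) : f⁻¹.orbital x = f.orbital x := by
  rw [orbital, orbital, Fix_inv]

open Classical in
theorem exists_isParametrization {f : Hplus} (hf : f ∈ HplusAC) {s : unitInterval}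
    (hs : f s ≠ s) : ∃ θ, f.IsParametrization s (if s < f s then 1 else -1) θ := by
  split_ifs with h
  · exact exists_isParametrization_of_lt hf h
  · have h' : f s < s := lt_of_le_of_ne (not_lt.1 h) hs
    -- Negative parity reduces to positive parity: `f⁻¹` has the same orbitals, and the translation
    -- changes direction.
    have h'' : s < f⁻¹ s := by
      rw [← f.lt_iff_lt]
      have : f (f⁻¹ s) = s := f.apply_symm_apply s
      rwa [this]
    obtain ⟨θ, h1⟩ := exists_isParametrization_of_lt (inv_mem hf) h''
    refine ⟨θ, h1.strictMono, h1.range_eq.trans (f.orbital_inv s), fun u => ?_, h1.image_null,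
      h1.preimage_null⟩
    have h2 := h1.map_apply (u + -1)
    rw [neg_add_cancel_right] at h2
    exact (inv_apply_eq_iff.1 h2).symm

theorem orbital_eq_of_mem {f : Hplus} {x y : unitInterval} (hx : f x ≠ x) (hy : y ∈ f.orbital x) :
    f.orbital y = f.orbital x := by
  obtain ⟨a, b, hax, hxb, ha, hb, h⟩ := f.exists_component hx
  rw [orbital_eq_Ioo ha hb h ⟨hax, hxb⟩] at hy ⊢
  exact orbital_eq_Ioo ha hb h hy

theorem ne_of_mem_orbital {f : Hplus} {x y : unitInterval} (hx : f x ≠ x)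
    (hy : y ∈ f.orbital x) : f y ≠ y := by
  obtain ⟨a, b, hax, hxb, ha, hb, h⟩ := f.exists_component hx
  rw [orbital_eq_Ioo ha hb h ⟨hax, hxb⟩] at hy
  exact h y hy

theorem not_separated_of_orbital_eq {f : Hplus} {x y : unitInterval} (hx : f x ≠ x)
    (hy : f y ≠ y) (h : f.orbital x = f.orbital y) : ¬ f.Separated x y := by
  intro h1
  rw [← precedes_orbital_iff hx hy, ← h] at h1
  exact lt_irrefl _ (h1 x (f.mem_orbital hx) x (f.mem_orbital hx))

theorem lt_apply_of_orbital_eq {f : Hplus} {x y : unitInterval} (hx : x < f x) (hy : f y ≠ y)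
    (h : f.orbital x = f.orbital y) : y < f y := by
  refine lt_of_not_ge fun hle => ?_
  have hlt : f y < y := lt_of_le_of_ne hle hy
  rcases lt_trichotomy x y with hxy | rfl | hxy
  · exact not_separated_of_orbital_eq hx.ne' hy h (exists_fixed_of_lt_of_gt hxy hx hlt)
  · exact lt_asymm hx hlt
  · exact not_separated_of_orbital_eq hy hx.ne' h.symm (exists_fixed_of_gt_of_lt hxy hlt hx)

theorem lt_apply_iff_of_orbital_eq {f : Hplus} {x y : unitInterval} (hx : f x ≠ x) (hy : f y ≠ y)
    (h : f.orbital x = f.orbital y) : x < f x ↔ y < f y :=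
  ⟨fun h' => lt_apply_of_orbital_eq h' hy h, fun h' => lt_apply_of_orbital_eq h' hx h.symm⟩

/-- Orbitals of nonzero parity are open, so representatives can be chosen in a countable dense set.
-/
theorem exists_representatives (f : Hplus) : ∃ S : Set unitInterval, S.Countable ∧
    (∀ s ∈ S, f s ≠ s) ∧ (∀ x, f x ≠ x → ∃ s ∈ S, f.orbital s = f.orbital x) ∧
    ∀ s ∈ S, ∀ t ∈ S, s < t → f.Separated s t := by
  obtain ⟨D, hDc, hD⟩ := TopologicalSpace.exists_countable_dense unitInterval
  have hr : ∀ J : f.nonzeroOrbitals, ∃ s ∈ D, s ∈ J.1 := by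
    rintro ⟨_, x, hx, rfl⟩
    obtain ⟨a, b, hax, hxb, ha, hb, h⟩ := f.exists_component hx
    change ∃ s ∈ D, s ∈ f.orbital x
    rw [orbital_eq_Ioo ha hb h ⟨hax, hxb⟩]
    exact hD.exists_mem_open isOpen_Ioo ⟨x, hax, hxb⟩ |>.imp fun s hs => ⟨hs.1, hs.2⟩
  choose r hrD hrJ using hr
  have hne : ∀ J, f (r J) ≠ r J := by
    rintro ⟨_, x, hx, rfl⟩
    exact ne_of_mem_orbital hx (hrJ ⟨_, x, hx, rfl⟩)
  have horb : ∀ J, f.orbital (r J) = J.1 := by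
    rintro ⟨_, x, hx, rfl⟩
    exact orbital_eq_of_mem hx (hrJ ⟨_, x, hx, rfl⟩)
  refine ⟨range r, hDc.mono (range_subset_iff.2 hrD), ?_, fun x hx => ?_, ?_⟩
  · rintro _ ⟨J, rfl⟩
    exact hne J
  · exact ⟨_, ⟨⟨_, x, hx, rfl⟩, rfl⟩, horb _⟩
  · rintro _ ⟨J, rfl⟩ _ ⟨K, rfl⟩ hlt
    by_contra h
    have := orbital_eq_of_not_separated (hne J) h (fun h' => lt_asymm hlt h'.lt) (hne K)
    rw [horb, horb] at this
    rw [Subtype.ext this] at hlt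
    exact lt_irrefl _ hlt

/-! ### Transversals as coloured dense orders -/

/-- `S` is a countable set containing exactly one point of each orbital of `f` of nonzero parity. -/
structure IsTransversal (f : Hplus) (S : Set unitInterval) : Prop where
  countable : S.Countable
  ne : ∀ s ∈ S, f s ≠ s
  exists_orbital_eq : ∀ x, f x ≠ x → ∃ s ∈ S, f.orbital s = f.orbital x
  separated : ∀ s ∈ S, ∀ t ∈ S, s < t → f.Separated s t

namespace IsTransversal

variable {f : Hplus} {S : Set unitInterval}

theorem exists_mem (hS : f.IsTransversal S) {v : unitInterval} (hv : f v ≠ v) :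
    ∃ s ∈ S, (s < f s ↔ v < f v) ∧ (∀ x, f x ≠ x → f.Separated x v → f.Separated x s) ∧
      ∀ x, f x ≠ x → f.Separated v x → f.Separated s x := by
  obtain ⟨s, hs, h⟩ := hS.exists_orbital_eq v hv
  have hs' := hS.ne s hs
  refine ⟨s, hs, lt_apply_iff_of_orbital_eq hs' hv h, fun x hx hxv => ?_, fun x hx hxv => ?_⟩
  · rwa [← precedes_orbital_iff hx hs', h, precedes_orbital_iff hx hv]
  · rwa [← precedes_orbital_iff hs' hx, h, precedes_orbital_iff hv hx]

theorem nonempty (hS : f.IsTransversal S) (hf : f.IsDenselyColored) : Nonempty S := by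
  obtain ⟨x, hx⟩ := hf.nonempty
  obtain ⟨s, hs, -⟩ := hS.exists_mem hx
  exact ⟨⟨s, hs⟩⟩

theorem noMinOrder (hS : f.IsTransversal S) (hf : f.IsDenselyColored) : NoMinOrder S := by
  refine ⟨fun s => ?_⟩
  obtain ⟨v, hv, hvs⟩ := hf.exists_left s (hS.ne s s.2)
  obtain ⟨t, ht, -, -, h⟩ := hS.exists_mem hv
  exact ⟨⟨t, ht⟩, (h s (hS.ne s s.2) hvs).lt⟩

theorem noMaxOrder (hS : f.IsTransversal S) (hf : f.IsDenselyColored) : NoMaxOrder S := by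
  refine ⟨fun s => ?_⟩
  obtain ⟨v, hv, hvs⟩ := hf.exists_right s (hS.ne s s.2)
  obtain ⟨t, ht, -, h, -⟩ := hS.exists_mem hv
  exact ⟨⟨t, ht⟩, (h s (hS.ne s s.2) hvs).lt⟩

/-- The colour of `s` is the truth value of `s < f s`, so the colours are the two propositions up to
equality. -/
theorem exists_colored_between (hS : f.IsTransversal S) (hf : f.IsDenselyColored) (s t : S)
    (hst : s < t) (c : Prop) : ∃ v : S, s < v ∧ v < t ∧ ((v : unitInterval) < f v) = c := by
  have h := hS.separated s s.2 t t.2 hst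
  by_cases hc : c
  · obtain ⟨v, h1, h2, h3⟩ := hf.exists_pos s t (hS.ne s s.2) (hS.ne t t.2) h
    obtain ⟨w, hw, hwc, k1, k2⟩ := hS.exists_mem h3.ne'
    exact ⟨⟨w, hw⟩, (k1 s (hS.ne s s.2) h1).lt, (k2 t (hS.ne t t.2) h2).lt,
      propext ⟨fun _ => hc, fun _ => hwc.2 h3⟩⟩
  · obtain ⟨v, h1, h2, h3⟩ := hf.exists_neg s t (hS.ne s s.2) (hS.ne t t.2) h
    obtain ⟨w, hw, hwc, k1, k2⟩ := hS.exists_mem h3.ne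
    exact ⟨⟨w, hw⟩, (k1 s (hS.ne s s.2) h1).lt, (k2 t (hS.ne t t.2) h2).lt,
      propext ⟨fun h' => absurd (hwc.1 h') h3.not_gt, fun h' => absurd h' hc⟩⟩

theorem denselyOrdered (hS : f.IsTransversal S) (hf : f.IsDenselyColored) : DenselyOrdered S :=
  ⟨fun s t h => (hS.exists_colored_between hf s t h True).imp fun _ h => ⟨h.1, h.2.1⟩⟩

/-- The order of the moved points is lexicographic in the coordinates `(s, u)`, so it depends only
on the order of the transversal. -/
theorem lt_iff (hS : f.IsTransversal S) {d : S → ℝ} {θ : S → ℝ → unitInterval}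
    (hθ : ∀ s : S, f.IsParametrization s (d s) (θ s)) (i j : S × ℝ) :
    θ i.1 i.2 < θ j.1 j.2 ↔ i.1 < j.1 ∨ i.1 = j.1 ∧ i.2 < j.2 := by
  have key : ∀ s t : S, s < t → ∀ u v, θ s u < θ t v := by
    intro s t hst u v
    refine (precedes_orbital_iff (hS.ne s s.2) (hS.ne t t.2)).2 (hS.separated s s.2 t t.2 hst) _ ?_
      _ ?_
    · rw [← (hθ s).range_eq]; exact ⟨u, rfl⟩
    · rw [← (hθ t).range_eq]; exact ⟨v, rfl⟩
  obtain ⟨s, u⟩ := i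
  obtain ⟨t, v⟩ := j
  rcases lt_trichotomy s t with h | rfl | h
  · simp only [key s t h, h, true_or]
  · simp only [(hθ s).strictMono.lt_iff_lt, lt_irrefl, false_or, true_and]
  · simp only [(key t s h v u).not_gt, h.not_gt, h.ne', false_and, or_false]

theorem exists_eq (hS : f.IsTransversal S) {d : S → ℝ} {θ : S → ℝ → unitInterval}
    (hθ : ∀ s : S, f.IsParametrization s (d s) (θ s)) {x : unitInterval} (hx : f x ≠ x) :
    ∃ s u, θ s u = x := by
  obtain ⟨s, hs, h⟩ := hS.exists_orbital_eq x hx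
  have h1 := f.mem_orbital hx
  rw [← h, ← (hθ ⟨s, hs⟩).range_eq] at h1
  exact ⟨⟨s, hs⟩, h1⟩

end IsTransversal

/-! ### Conjugacy of the elements of `C ∩ N` -/

theorem dense_setOf_not_fixed {f : Hplus} (hf : volume f.Fix = 0) : Dense {x | f x ≠ x} :=
  dense_of_exists_between fun _ _ h =>
    (exists_not_fixed hf h).imp fun _ hv => ⟨hv.2.2, hv.1, hv.2.1⟩

/-- Outside `A` the map `h` is a countable union of pieces `η i ∘ (θ i)⁻¹`, each of which preserves
null sets. -/
theorem volume_image_eq_zero_of_parametrizations {ι : Type*} [Countable ι]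
    {θ η : ι → ℝ → unitInterval} {h : Hplus} (hh : ∀ i u, h (θ i u) = η i u)
    {A : Set unitInterval} (hA : volume (h '' A) = 0) (hAθ : ∀ x ∉ A, ∃ i u, θ i u = x)
    (hθ : ∀ i, ∀ E : Set unitInterval, volume E = 0 → volume (θ i ⁻¹' E) = 0)
    (hη : ∀ i, ∀ E : Set ℝ, volume E = 0 → volume (η i '' E) = 0) (E : Set unitInterval)
    (hE : volume E = 0) : volume (h '' E) = 0 := by
  refine measure_mono_null (t := h '' A ∪ ⋃ i, η i '' (θ i ⁻¹' E)) ?_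
    (measure_union_null hA (measure_iUnion_null fun i => hη i _ (hθ i E hE)))
  rintro _ ⟨x, hx, rfl⟩
  by_cases hxA : x ∈ A
  · exact Or.inl ⟨x, hxA, rfl⟩
  · obtain ⟨i, u, rfl⟩ := hAθ x hxA
    exact Or.inr (mem_iUnion.2 ⟨i, u, hx, (hh i u).symm⟩)

theorem exists_conj {f g : Hplus} (hf : f ∈ HplusAC) (hg : g ∈ HplusAC)
    (hfC : f.IsDenselyColored) (hgC : g.IsDenselyColored) (hfN : volume f.Fix = 0)
    (hgN : volume g.Fix = 0) : ∃ h ∈ HplusAC, ∀ x, h (f x) = g (h x) := by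
  classical
  obtain ⟨S, s1, s2, s3, s4⟩ := f.exists_representatives
  obtain ⟨T, t1, t2, t3, t4⟩ := g.exists_representatives
  have hS : f.IsTransversal S := ⟨s1, s2, s3, s4⟩
  have hT : g.IsTransversal T := ⟨t1, t2, t3, t4⟩
  have := hS.nonempty hfC
  have := hS.noMinOrder hfC
  have := hS.noMaxOrder hfC
  have := hS.denselyOrdered hfC
  have := hT.nonempty hgC
  have := hT.noMinOrder hgC
  have := hT.noMaxOrder hgC
  have := hT.denselyOrdered hgC
  have : Countable S := s1.to_subtype
  have : Countable T := t1.to_subtype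
  obtain ⟨e, he⟩ := exists_colored_orderIso (C := Prop)
    (a := fun s : S => (s : unitInterval) < f s) (b := fun t : T => (t : unitInterval) < g t)
    (hS.exists_colored_between hfC) (hT.exists_colored_between hgC)
  choose θ hθ using fun s : S => exists_isParametrization hf (s2 s s.2)
  choose η hη using fun t : T => exists_isParametrization hg (t2 t t.2)
  have hp : Dense (range fun i : S × ℝ => θ i.1 i.2) :=
    (dense_setOf_not_fixed hfN).mono fun x hx => by
      obtain ⟨s, u, h⟩ := hS.exists_eq hθ hx
      exact ⟨(s, u), h⟩
  have hTη : ∀ x, g x ≠ x → ∃ s u, η (e s) u = x := fun x hx => by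
    obtain ⟨t, u, h⟩ := hT.exists_eq hη hx
    exact ⟨e.symm t, u, by rw [e.apply_symm_apply, h]⟩
  have hq : Dense (range fun i : S × ℝ => η (e i.1) i.2) :=
    (dense_setOf_not_fixed hgN).mono fun x hx => by
      obtain ⟨s, u, h⟩ := hTη x hx
      exact ⟨(s, u), h⟩
  obtain ⟨h, hh⟩ := exists_orderIso_of_lt_iff_lt hp hq fun i j => by
    rw [hS.lt_iff hθ, hT.lt_iff hη (e i.1, i.2) (e j.1, j.2), e.lt_iff_lt, e.injective.eq_iff]
  have hh' : ∀ s u, h (θ s u) = η (e s) u := fun s u => hh (s, u)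
  -- On corresponding orbitals `f` and `g` are the same translation, since `e` preserves parity. So
  -- the identity holds on a dense set, and continuity extends it.
  have hconj : ∀ x, h (f x) = g (h x) := by
    have := Continuous.ext_on hp (h.continuous.comp f.continuous)
      (g.continuous.comp h.continuous) (by
        rintro _ ⟨⟨s, u⟩, rfl⟩
        simp only [Function.comp]
        rw [(hθ s).map_apply, hh', hh', (hη (e s)).map_apply]
        simp only [he s])
    exact congrFun this
  refine ⟨h, mem_HplusAC_iff.2 ⟨?_, ?_⟩, hconj⟩
  -- The conjugacy carries `Fix f` into the null set `Fix g`, so only the orbitals matter; the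
  -- inverse is treated symmetrically.
  · refine volume_image_eq_zero_of_parametrizations (A := f.Fix) hh' (measure_mono_null ?_ hgN)
      (fun x hx => hS.exists_eq hθ hx) (fun s => (hθ s).preimage_null)
      (fun s => (hη (e s)).image_null)
    rintro _ ⟨x, hx, rfl⟩
    exact (hconj x).symm.trans (congrArg h hx)
  · refine volume_image_eq_zero_of_parametrizations (A := g.Fix) (h := h.symm)
      (θ := fun s => η (e s)) (η := θ)
      (fun s u => by rw [← hh', OrderIso.symm_apply_apply]) (measure_mono_null ?_ hfN)
      (fun x hx => hTη x hx) (fun s => (hη (e s)).preimage_null) (fun s => (hθ s).image_null)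
    rintro _ ⟨x, hx, rfl⟩
    refine h.injective ?_
    rw [hconj, OrderIso.apply_symm_apply]
    exact hx

theorem IsAlternating.conj {f : Hplus} (hf : f.IsAlternating) (h : Hplus) :
    (h * f * h⁻¹).IsAlternating := by
  intro z hz U hU
  have hz' : f (h⁻¹ z) = h⁻¹ z :=
    (inv_apply_eq_iff (f := h).2 hz.symm).symm
  have hzz : h (h⁻¹ z) = z := h.apply_symm_apply z
  have hV : h ⁻¹' U ∈ 𝓝 (h⁻¹ z) := h.continuous.continuousAt.preimage_mem_nhds (by rwa [hzz])
  have key : ∀ x, (h * f * h⁻¹) (h x) = h (f x) := fun x => by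
    have : h⁻¹ (h x) = x := h.symm_apply_apply x
    rw [RelIso.mul_apply, RelIso.mul_apply, this]
  obtain ⟨x₁, h1, x₂, h2, x₃, h3, h12, h23, p1, p2, p3⟩ := hf _ hz' _ hV
  refine ⟨h x₁, h1, h x₂, h2, h x₃, h3, h.strictMono h12, h.strictMono h23, ?_, ?_, ?_⟩ <;>
    rw [key]
  · exact h.strictMono p1
  · exact h.strictMono p2
  · exact h.strictMono p3

theorem Fix_conj (f h : Hplus) : (h * f * h⁻¹).Fix = h '' f.Fix := by
  ext z
  have hzz : h (h⁻¹ z) = z := h.apply_symm_apply z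
  constructor
  · intro hz
    exact ⟨h⁻¹ z, (inv_apply_eq_iff (f := h).2 (Eq.symm hz)).symm, hzz⟩
  · rintro ⟨x, hx, rfl⟩
    have h1 : h⁻¹ (h x) = x := h.symm_apply_apply x
    have hx' : f x = x := hx
    change h (f (h⁻¹ (h x))) = h x
    rw [h1, hx']

end Hplus

/-! ### Generic elements -/

namespace HplusAC

theorem setCN_eq_conjugatesOf {f : HplusAC} (hf : f ∈ setCN) : setCN = conjugatesOf f := by
  have hf' := hf
  rw [setCN_eq] at hf'
  ext g
  change _ ↔ IsConj f g
  rw [isConj_iff]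
  constructor
  · intro hg
    rw [setCN_eq] at hg
    obtain ⟨h, hh, hc⟩ := Hplus.exists_conj f.2 g.2 hf'.1.isDenselyColored hg.1.isDenselyColored
      hf'.2 hg.2
    refine ⟨⟨h, hh⟩, mul_inv_eq_iff_eq_mul.2 (Subtype.ext (RelIso.ext fun x => hc x))⟩
  · rintro ⟨h, rfl⟩
    rw [setCN_eq]
    refine ⟨hf'.1.conj h.1, ?_⟩
    change volume (h.1 * f.1 * h.1⁻¹).Fix = 0
    rw [Hplus.Fix_conj]
    exact h.2.1.volume_image_eq_zero hf'.2

/-- In a Baire space two comeagre sets meet, so a comeagre class contains an element of `setCN` and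
therefore coincides with it. -/
theorem setOf_isGenericElement_eq : {f : HplusAC | IsGenericElement f} = setCN := by
  have hres : setCN ∈ residual HplusAC := residual_of_dense_Gδ isGδ_setCN dense_setCN
  ext f
  constructor
  · intro hf
    obtain ⟨g, hg1, hg2⟩ := (dense_of_mem_residual (inter_mem hf hres)).nonempty
    rw [setCN_eq_conjugatesOf hg2]
    exact IsConj.symm (hg1 : IsConj f g)
  · intro hf
    change conjugatesOf f ∈ residual HplusAC
    rwa [← setCN_eq_conjugatesOf hf]

end HplusAC

theorem mainTheorem2 :
    -- generic elements exist
    (∃ f : HplusAC, IsGenericElement f) ∧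
    -- the generic elements are exactly those with the properties (i), (ii), (iii)
    (∀ f : HplusAC, IsGenericElement f ↔
      -- (i) the (nonempty, compact) fixed point set is a Cantor set
      (IsTotallyDisconnected f.1.Fix ∧ Preperfect f.1.Fix) ∧
      -- (ii) between any two components there are points of both parities
      (∀ a b c d : unitInterval, Ioo a b ∈ f.1.nonzeroOrbitals → Ioo c d ∈ f.1.nonzeroOrbitals →
        b < c → ∃ x ∈ Ioo b c, ∃ y ∈ Ioo b c, f.1 x < x ∧ y < f.1 y) ∧
      -- (iii) the fixed point set is Lebesgue-null
      volume ((fun x : unitInterval => (x : ℝ)) '' f.1.Fix) = 0) ∧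
    -- the generic elements form a single conjugacy class, and they are the set `C ∩ N ∩ H₊^{AC}`
    (∃ f : HplusAC, HplusAC.setCN = conjugatesOf f) ∧
    {f : HplusAC | IsGenericElement f} = HplusAC.setCN ∧
    -- which is a dense `G_δ` set
    IsGδ HplusAC.setCN ∧
    Dense HplusAC.setCN := by
  obtain ⟨f, hf⟩ := HplusAC.dense_setCN.nonempty
  have h := HplusAC.setOf_isGenericElement_eq
  refine ⟨⟨f, h.symm.subset hf⟩, fun g => ?_, ⟨f, HplusAC.setCN_eq_conjugatesOf hf⟩, h,
    HplusAC.isGδ_setCN, HplusAC.dense_setCN⟩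
  rw [← Hplus.mem_setC_inter_setN_iff_isTotallyDisconnected]
  exact Set.ext_iff.1 h g
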